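/- Let $n\ge 0$ be an integer. Let $\mathbb T^n=(\mathbb R/\mathbb Z)^n$ carry the Haar measure $dw$ of total mass $1$, and $\mathbb Z^n\times\mathbb T^n$ the product $\mu$ of counting measure and $dw$. For $(m,w)\in\mathbb Z^n\times\mathbb T^n$ put $M_wT_mg(k)=e^{2\pi i w\cdot k}g(k-m)$, and let $\langle f,h\rangle=\sum_{k\in\mathbb Z^n}f(k)\overline{h(k)}$ and $V_gf(m,w)=\langle f,M_wT_mg\rangle$. Fix non-zero Schwartz windows: $\varphi\in\mathcal S(\mathbb Z^n)$ (rapidly decreasing) and $\Phi\in\mathcal S(\mathbb Z^n\times\mathbb T^n)$ (smooth on $\mathbb T^n$, with all torus derivatives rapidly decreasing in the $\mathbb Z^n$ variable, uniformly on $\mathbb T^n$). The space $M^1(\mathbb Z^n)$ consists of the functions $f:\mathbb Z^n\to\mathbb C$ of at most polynomial growth (that is, the tempered distributions on $\mathbb Z^n$) with $$\|f\|_{M^1(\mathbb Z^n)}=\sum_{m\in\mathbb Z^n}\int_{\mathbb T^n}|V_\varphi f(m,w)|\,dw<\infty .$$ The space $M^1(\mathbb Z^n\times\mathbb T^n)$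 consists of the measurable functions $F$ on $\mathbb Z^n\times\mathbb T^n$ with $\sum_m\int(1+|m|)^{-N}|F(m,w)|\,dw<\infty$ for some $N$, such that $$\|F\|_{M^1(\mathbb Z^n\times\mathbb T^n)}=\int\!\!\int|V_\Phi F(z,\zeta)|\,d\mu(\zeta)\,d\mu(z)<\infty,\qquad V_\Phi F(z,\zeta)=\int F(x)\,\overline{\chi_\zeta(x)\,\Phi(x-z)}\,d\mu(x),$$ where $\chi_{(j,\xi)}(l,y)=e^{2\pi i(\xi\cdot l+j\cdot y)}$ runs through the characters of $\mathbb Z^n\times\mathbb T^n$ for $(j,\xi)\in\mathbb Z^n\times\mathbb T^n$. Call the pair $(\varphi,\Phi)$ normalised if $|\varphi(k)|\ge1$ for some $k$, $|\Phi(z)|\ge 1$ for some $z$, and $\sum_{m,j\in\mathbb Z^n}\bigl|\int_{\mathbb T^n}\Phi(m,w)e^{-2\pi i j\cdot w}\,dw\bigr|\le1$; for example, $\varphi(k)=\delta_{k,0}$ and $\Phi(m,w)=\delta_{m,0}$. **Theorem.** There is a constant $C>0$, depending only on $n,\varphi,\Phi$, with $C=1$ whenever $(\varphi,\Phi)$ is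 normalised, such that the following holds for all $\sigma\in M^1(\mathbb Z^n\times\mathbb T^n)$ and $g\in M^1(\mathbb Z^n)$. The localization operator $$L_\sigma^{g,g}f(k)=\sum_{m\in\mathbb Z^n}\int_{\mathbb T^n}\sigma(m,w)\,V_gf(m,w)\,M_wT_mg(k)\,dw$$ is a bounded operator on $\ell^2(\mathbb Z^n)$ and belongs to the trace class $S_1$, i.e. it is compact and the sum $\|L_\sigma^{g,g}\|_{S_1}$ of its singular values (the eigenvalues of $|L_\sigma^{g,g}|$, counted with multiplicity) is finite. The function $\tilde\sigma(m,w)=\langle L_\sigma^{g,g}(M_wT_mg),M_wT_mg\rangle$ belongs to $M^1(\mathbb Z^n\times\mathbb T^n)$. Moreover $$\|L_\sigma^{g,g}\|_{S_1}\le C\,\|g\|_{M^1(\mathbb Z^n)}^2\,\|\sigma\|_{M^1(\mathbb Z^n\times\mathbb T^n)},$$ and, if $g\ne0$, $$\frac{\|\tilde\sigma\|_{M^1(\mathbb Z^n\times\mathbb T^n)}}{\|g\|_{M^1(\mathbb Z^n)}^2}\le C\,\|L_\sigma^{g,g}\|_{S_1}.$$ -/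

import Mathlib

open MeasureTheory
open scoped ENNReal NNReal ComplexConjugate ContDiff

noncomputable section

namespace DiscreteTF

/-- The lattice `ℤⁿ`. -/
abbrev IntVec (n : ℕ) : Type := Fin n → ℤ

/-- The torus `𝕋ⁿ = (ℝ/ℤ)ⁿ`. -/
abbrev Torus (n : ℕ) : Type := UnitAddTorus (Fin n)

/-- The phase space `ℤⁿ × 𝕋ⁿ`. -/
abbrev Phase (n : ℕ) : Type := IntVec n × Torus n

/-- The Hilbert space `ℓ²(ℤⁿ)`. -/
abbrev EllTwo (n : ℕ) : Type := lp (fun _ : IntVec n => ℂ) 2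

/-- The normalised Haar measure `dw` on `𝕋ⁿ` (total mass one). -/
def torusMeasure (n : ℕ) : Measure (Torus n) :=
  Measure.pi fun _ => (AddCircle.haarAddCircle : Measure UnitAddCircle)

/-- Counting measure on `ℤⁿ` times normalised Haar measure on `𝕋ⁿ`. -/
def phaseMeasure (n : ℕ) : Measure (Phase n) :=
  (Measure.count : Measure (IntVec n)).prod (torusMeasure n)

/-! ### Time-frequency analysis on `ℤⁿ` -/

/-- The time-frequency shift `M_w T_m g (k) = e^{2 π i w · k} g (k - m)`, for `z = (m, w)`. -/
def tfShift {n : ℕ} (z : Phase n) (g : IntVec n → ℂ) (k : IntVec n) : ℂ :=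
  UnitAddTorus.mFourier k z.2 * g (k - z.1)

/-- The pairing `⟨f, h⟩ = ∑ k, f k * conj (h k)`, linear in the first argument. -/
def pairing {n : ℕ} (f h : IntVec n → ℂ) : ℂ :=
  ∑' k, f k * conj (h k)

/-- The short-time Fourier transform `V_g f (m, w) = ⟨f, M_w T_m g⟩`. -/
def stft {n : ℕ} (g f : IntVec n → ℂ) (z : Phase n) : ℂ :=
  pairing f (tfShift z g)

/-- The Schwartz space `𝓢(ℤⁿ)`: rapidly decreasing functions. -/
def IsSchwartz {n : ℕ} (φ : IntVec n → ℂ) : Prop :=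
  ∀ N : ℕ, ∃ C : ℝ, ∀ k, (1 + ‖k‖) ^ N * ‖φ k‖ ≤ C

/-- The tempered distributions on `ℤⁿ`: these are exactly the functions on `ℤⁿ` of at most
polynomial growth, acting by summation. -/
def IsTempered {n : ℕ} (f : IntVec n → ℂ) : Prop :=
  ∃ (N : ℕ) (C : ℝ), ∀ k, ‖f k‖ ≤ C * (1 + ‖k‖) ^ N

/-- The norm of `M¹(ℤⁿ)` computed with the window `φ`. -/
def m1Norm {n : ℕ} (φ f : IntVec n → ℂ) : ℝ≥0∞ :=
  ∑' m : IntVec n, ∫⁻ w, ‖stft φ f (m, w)‖ₑ ∂(torusMeasure n)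

/-- Membership in the modulation space `M¹(ℤⁿ)`, tested with the window `φ`. -/
def MemM1 {n : ℕ} (φ f : IntVec n → ℂ) : Prop :=
  IsTempered f ∧ m1Norm φ f < ⊤

/-! ### Time-frequency analysis on `ℤⁿ × 𝕋ⁿ`

The dual group of `ℤⁿ × 𝕋ⁿ` is `𝕋ⁿ × ℤⁿ`; a frequency `(ξ, j) ∈ 𝕋ⁿ × ℤⁿ` is written as
`ζ = (j, ξ) : Phase n`, and Haar measure on the dual group is `phaseMeasure n` as well. -/

/-- The character `(l, y) ↦ e^{2 π i (ξ · l + j · y)}` of `ℤⁿ × 𝕋ⁿ`, for `ζ = (j, ξ)`. -/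
def phaseChar {n : ℕ} (ζ x : Phase n) : ℂ :=
  UnitAddTorus.mFourier x.1 ζ.2 * UnitAddTorus.mFourier ζ.1 x.2

/-- The short-time Fourier transform on `ℤⁿ × 𝕋ⁿ`: the pairing of `F` with the translate by `z`
of `Φ`, modulated by `ζ`. -/
def phaseStft {n : ℕ} (Φ F : Phase n → ℂ) (z ζ : Phase n) : ℂ :=
  ∫ x, F x * conj (phaseChar ζ x * Φ (x - z)) ∂(phaseMeasure n)

/-- The slice `Φ (m, ·)` lifted to a `ℤⁿ`-periodic function on `ℝⁿ`. -/
def liftSlice {n : ℕ} (Φ : Phase n → ℂ) (m : IntVec n) (x : Fin n → ℝ) : ℂ :=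
  Φ (m, fun i => (x i : UnitAddCircle))

/-- The Schwartz space `𝓢(ℤⁿ × 𝕋ⁿ)`: smooth in the torus variable, all derivatives being rapidly
decreasing in the lattice variable, uniformly on the torus. -/
def IsPhaseSchwartz {n : ℕ} (Φ : Phase n → ℂ) : Prop :=
  (∀ m, ContDiff ℝ ∞ (liftSlice Φ m)) ∧
    ∀ N r : ℕ, ∃ C : ℝ, ∀ m x,
      (1 + ‖m‖) ^ N * ‖iteratedFDeriv ℝ r (liftSlice Φ m) x‖ ≤ C

/-- Measurable functions on `ℤⁿ × 𝕋ⁿ` that are integrable against some weight `(1 + |m|)^{-N}`.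
They define tempered distributions by integration, and include all of `L¹` and `L^∞`. -/
def IsPhaseTempered {n : ℕ} (F : Phase n → ℂ) : Prop :=
  ∃ N : ℕ, Integrable (fun z : Phase n => (((1 + ‖z.1‖) ^ N)⁻¹ : ℝ) • F z) (phaseMeasure n)

/-- The norm of `M¹(ℤⁿ × 𝕋ⁿ)` computed with the window `Φ`. -/
def phaseM1Norm {n : ℕ} (Φ F : Phase n → ℂ) : ℝ≥0∞ :=
  ∫⁻ z, ∫⁻ ζ, ‖phaseStft Φ F z ζ‖ₑ ∂(phaseMeasure n) ∂(phaseMeasure n)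

/-- Membership in the modulation space `M¹(ℤⁿ × 𝕋ⁿ)`, tested with the window `Φ`. -/
def PhaseMemM1 {n : ℕ} (Φ F : Phase n → ℂ) : Prop :=
  IsPhaseTempered F ∧ phaseM1Norm Φ F < ⊤

/-- The pair of windows used for the norms of `M¹(ℤⁿ)` and `M¹(ℤⁿ × 𝕋ⁿ)` is normalised:
`φ` and `Φ` take a value of modulus at least one, and the Fourier coefficients of the slices
`Φ (m, ·)` have absolute sum at most one. The standard choice is `φ = δ₀`, `Φ (m, w) = δ₀ (m)`. -/
def NormalizedWindows {n : ℕ} (φ : IntVec n → ℂ) (Φ : Phase n → ℂ) : Prop :=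
  (∃ k, 1 ≤ ‖φ k‖) ∧ (∃ z, 1 ≤ ‖Φ z‖) ∧
    ∑' m : IntVec n, ∑' j : IntVec n,
      ‖∫ w, Φ (m, w) * conj (UnitAddTorus.mFourier j w) ∂(torusMeasure n)‖ₑ ≤ 1

/-! ### Localization operators and the trace class -/

/-- The localization operator with symbol `σ` and windows `g₁`, `g₂`, as a formula:
`∑ m, ∫ σ(m, w) V_{g₁} f (m, w) M_w T_m g₂ (k) dw`. -/
def locOp {n : ℕ} (σ : Phase n → ℂ) (g₁ g₂ f : IntVec n → ℂ) (k : IntVec n) : ℂ :=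
  ∑' m : IntVec n, ∫ w, σ (m, w) * stft g₁ f (m, w) * tfShift (m, w) g₂ k ∂(torusMeasure n)

/-- The function `σ̃ (m, w) = ⟨L (M_w T_m g), M_w T_m g⟩`, with `L` the localization operator with
symbol `σ` and both windows equal to `g`. -/
def lowerSymbol {n : ℕ} (σ : Phase n → ℂ) (g : IntVec n → ℂ) (z : Phase n) : ℂ :=
  pairing (locOp σ g g (tfShift z g)) (tfShift z g)

/-- The norm `‖A‖_{S₁}` of a compact operator: the sum of its singular values, that is, of the
eigenvalues of `|A| = (A* A)^{1/2}` repeated according to multiplicity (terms with `μ ≤ 0` are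
zero; for compact `A` the eigenspaces with `μ > 0` are finite-dimensional). -/
def traceNorm {H : Type*} [NormedAddCommGroup H] [InnerProductSpace ℂ H] [CompleteSpace H]
    (A : H →L[ℂ] H) : ℝ≥0∞ :=
  ∑' μ : ℝ, ENNReal.ofReal μ *
    (Module.finrank ℂ (Module.End.eigenspace
      ((CFC.abs A : H →L[ℂ] H) : H →ₗ[ℂ] H) (μ : ℂ)) : ℝ≥0∞)

/-- The trace class `S₁`: compact operators with summable singular values. -/
def IsTraceClass {H : Type*} [NormedAddCommGroup H] [InnerProductSpace ℂ H] [CompleteSpace H]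
    (A : H →L[ℂ] H) : Prop :=
  IsCompactOperator A ∧ traceNorm A < ⊤

end DiscreteTF

end

noncomputable section

namespace DiscreteTF

variable {n : ℕ}

/-! Everything passes through absolute integrability. For fixed `z`, the transform `V_Φ F(z, ·)` is
the Fourier transform of `F` times a translated window, and a function is bounded almost everywhere
by the `L¹` norm of its Fourier transform. Averaging over `z` gives `|Φ(z₀)| ‖F‖₁ ≤ ‖F‖_{M¹}` for
every `z₀` (`enorm_mul_lintegral_le_phaseM1Norm`), and likewise `|φ(k₀)| ‖g‖₁ ≤ ‖g‖_{M¹}`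
(`enorm_mul_tsum_le_m1Norm`).

Upper bound: `L` is the operator-norm integral of `σ(z)` times the rank one operator built on the
shifted window, whose trace norm is at most `‖g‖₁²`. Hence `‖L‖_{S₁} ≤ ‖g‖₁² ‖σ‖₁`
(`traceNorm_locOperator_le`).

Lower bound: expanding both shifts in the standard basis exhibits each slice `σ̃(m, ·)` as a
trigonometric series with coefficients `conj g(l-m) g(k-m) ⟨L δ_k, δ_l⟩`. Splitting `L` along an
orthonormal basis containing its singular vectors and applying Cauchy-Schwarz in `m` bounds the sum
of all coefficients by `‖g‖₁² ‖L‖_{S₁}` (`tsum_lowerSymbol_coeff_le`). The `M¹` norm of such a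
series is at most this sum times `wienerNorm Φ` (`phaseM1Norm_sliceSeries_le`), which is finite for
a Schwartz window.

The constant must therefore exceed `1 / (|φ(k₀)|² |Φ(z₀)|)` and `wienerNorm Φ / |φ(k₀)|²`; for
normalised windows both can be made at most one. -/

instance : IsProbabilityMeasure (torusMeasure n) := by
  unfold torusMeasure; infer_instance

instance : (torusMeasure n).IsAddHaarMeasure := by
  unfold torusMeasure; infer_instance

/-! ### Integration over phase space, slice by slice -/

theorem phaseMeasure_eq_sum :
    phaseMeasure n = Measure.sum fun l : IntVec n => (torusMeasure n).map (Prod.mk l) := by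
  simp only [phaseMeasure, Measure.count, Measure.prod_sum_left, Measure.dirac_prod]

theorem ae_phase_iff {p : Phase n → Prop} :
    (∀ᵐ x ∂phaseMeasure n, p x) ↔ ∀ l, ∀ᵐ w ∂torusMeasure n, p (l, w) := by
  rw [phaseMeasure_eq_sum, Measure.ae_sum_iff]
  exact forall_congr' fun l => (measurableEmbedding_prodMk_left l).ae_map_iff

theorem lintegral_phase (f : Phase n → ℝ≥0∞) :
    ∫⁻ x, f x ∂phaseMeasure n = ∑' l, ∫⁻ w, f (l, w) ∂torusMeasure n := by
  rw [phaseMeasure_eq_sum, lintegral_sum_measure]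
  exact tsum_congr fun l => (measurableEmbedding_prodMk_left l).lintegral_map _

theorem integrable_slice {E : Type*} [NormedAddCommGroup E] {f : Phase n → E}
    (hf : Integrable f (phaseMeasure n)) (l : IntVec n) :
    Integrable (fun w => f (l, w)) (torusMeasure n) := by
  rw [phaseMeasure_eq_sum] at hf
  exact (measurableEmbedding_prodMk_left l).integrable_map_iff.1
    (hf.mono_measure (Measure.le_sum _ l))

theorem hasSum_integral_phase {E : Type*} [NormedAddCommGroup E] [NormedSpace ℝ E]
    {f : Phase n → E} (hf : Integrable f (phaseMeasure n)) :
    HasSum (fun l => ∫ w, f (l, w) ∂torusMeasure n) (∫ x, f x ∂phaseMeasure n) := by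
  rw [phaseMeasure_eq_sum] at hf ⊢
  convert hasSum_integral_measure hf using 2 with l
  exact ((measurableEmbedding_prodMk_left l).integral_map _).symm

/-! ### Fourier series on the torus -/

@[simp] theorem norm_mFourier_apply (k : IntVec n) (w : Torus n) :
    ‖UnitAddTorus.mFourier k w‖ = 1 := by
  rw [UnitAddTorus.mFourier, ContinuousMap.coe_mk, norm_prod]
  exact Finset.prod_eq_one fun _ _ => Circle.norm_coe _

@[simp] theorem enorm_mFourier_apply (k : IntVec n) (w : Torus n) :
    ‖UnitAddTorus.mFourier k w‖ₑ = 1 := by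
  rw [← ofReal_norm, norm_mFourier_apply, ENNReal.ofReal_one]

theorem mFourier_apply_add (k : IntVec n) (w v : Torus n) :
    UnitAddTorus.mFourier k (w + v) = UnitAddTorus.mFourier k w * UnitAddTorus.mFourier k v := by
  simp [UnitAddTorus.mFourier, fourier_apply, AddCircle.toCircle_add, Finset.prod_mul_distrib]

theorem integral_mFourier (k : IntVec n) :
    ∫ w, UnitAddTorus.mFourier k w ∂torusMeasure n = if k = 0 then 1 else 0 := by
  have h := orthonormal_iff_ite.mp (UnitAddTorus.orthonormal_mFourier (d := Fin n)) 0 k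
  simp only [ContinuousMap.inner_toLp, UnitAddTorus.mFourier_zero] at h
  simpa [eq_comm, torusMeasure, volume] using! h

theorem integral_mFourier_mul_conj (k l : IntVec n) :
    ∫ w, UnitAddTorus.mFourier k w * conj (UnitAddTorus.mFourier l w) ∂torusMeasure n =
      if k = l then 1 else 0 := by
  simp_rw [← UnitAddTorus.mFourier_neg, ← UnitAddTorus.mFourier_add, integral_mFourier,
    add_neg_eq_zero]

theorem hasSum_integral_mul_of_summable {ι : Type*} [Countable ι] {α : Type*} [MeasurableSpace α]
    {μ : Measure α} [IsFiniteMeasure μ] {f : ι → α → ℂ} (hf : ∀ i, AEStronglyMeasurable (f i) μ)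
    {b : ι → ℝ} (hb : Summable b) (hfb : ∀ i x, ‖f i x‖ ≤ b i) :
    HasSum (fun i => ∫ x, f i x ∂μ) (∫ x, ∑' i, f i x ∂μ) := by
  refine hasSum_integral_of_dominated_convergence (fun i _ => b i) hf
    (fun i => .of_forall (hfb i)) (.of_forall fun _ => hb) (integrable_const _)
    (.of_forall fun x => (Summable.of_norm_bounded hb (hfb · x)).hasSum)

theorem continuous_mFourier (k : IntVec n) : Continuous (UnitAddTorus.mFourier k) :=
  (UnitAddTorus.mFourier k).continuous

theorem integral_tsum_mFourier {a : IntVec n → ℂ} (ha : Summable fun k => ‖a k‖) (l : IntVec n) :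
    ∫ w, (∑' k, a k * UnitAddTorus.mFourier k w) * conj (UnitAddTorus.mFourier l w)
      ∂torusMeasure n = a l := by
  have h := hasSum_integral_mul_of_summable (μ := torusMeasure n)
    (f := fun k w => a k * UnitAddTorus.mFourier k w * conj (UnitAddTorus.mFourier l w))
    (fun k => by have := continuous_mFourier k; have := continuous_mFourier l
                 exact Continuous.aestronglyMeasurable (by fun_prop)) ha (fun k x => by simp)
  simp_rw [tsum_mul_right] at h
  rw [← h.tsum_eq]
  simp_rw [mul_assoc, integral_const_mul, integral_mFourier_mul_conj]
  simp

/-- Thickened indicators are continuous and decrease to the indicator of a closed set, so by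
dominated convergence `h` integrates to zero over every closed set. -/
theorem ae_eq_zero_of_forall_integral_continuous {h : Torus n → ℂ}
    (hh : Integrable h (torusMeasure n))
    (h0 : ∀ f : C(Torus n, ℂ), ∫ w, h w * f w ∂torusMeasure n = 0) :
    h =ᵐ[torusMeasure n] 0 := by
  refine ae_eq_zero_of_forall_setIntegral_isClosed_eq_zero hh fun s hs => ?_
  have hpos : ∀ k : ℕ, (0 : ℝ) < 1 / ((k : ℝ) + 1) := fun k => by positivity
  have hlim : Filter.Tendsto (fun k : ℕ => ∫ w, h w * ((thickenedIndicator (hpos k) s w : ℝ≥0) : ℝ)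
      ∂torusMeasure n) Filter.atTop (nhds (∫ w, s.indicator h w ∂torusMeasure n)) := by
    refine tendsto_integral_of_dominated_convergence (fun w => ‖h w‖) ?_ hh.norm ?_ ?_
    · intro k
      refine hh.1.mul (Continuous.aestronglyMeasurable ?_)
      have := (thickenedIndicator (hpos k) s).continuous
      fun_prop
    · refine fun k => .of_forall fun w => ?_
      rw [norm_mul]
      refine mul_le_of_le_one_right (norm_nonneg _) ?_
      have := thickenedIndicator_le_one (hpos k) s w
      simpa using this
    · refine .of_forall fun w => ?_
      have := thickenedIndicator_tendsto_indicator_closure hpos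
        tendsto_one_div_add_atTop_nhds_zero_nat s
      rw [tendsto_pi_nhds, hs.closure_eq] at this
      have h2 := ((Complex.continuous_ofReal.comp NNReal.continuous_coe).tendsto _).comp (this w)
      have h3 := h2.const_mul (h w)
      convert h3 using 2
      · simp
      · by_cases hw : w ∈ s <;> simp [hw]
  rw [integral_indicator hs.measurableSet] at hlim
  refine tendsto_nhds_unique hlim ?_
  refine (tendsto_const_nhds (x := (0 : ℂ))).congr fun k => ?_
  exact (h0 ⟨fun w => ((thickenedIndicator (hpos k) s w : ℝ≥0) : ℝ), by
    have := (thickenedIndicator (hpos k) s).continuous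
    fun_prop⟩).symm

/-- Integration against `h` is a bounded functional on `C(𝕋ⁿ)` that vanishes on the characters,
whose span is dense. -/
theorem ae_eq_zero_of_fourier_eq_zero {h : Torus n → ℂ} (hh : Integrable h (torusMeasure n))
    (h0 : ∀ j, ∫ w, h w * conj (UnitAddTorus.mFourier j w) ∂torusMeasure n = 0) :
    h =ᵐ[torusMeasure n] 0 := by
  refine ae_eq_zero_of_forall_integral_continuous hh fun f => ?_
  have hint : ∀ f : C(Torus n, ℂ), Integrable (fun w => h w * f w) (torusMeasure n) := fun f =>
    hh.mul_bdd f.continuous.aestronglyMeasurable (.of_forall fun w => f.norm_coe_le_norm w)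
  let T : C(Torus n, ℂ) →ₗ[ℂ] ℂ :=
    { toFun := fun f => ∫ w, h w * f w ∂torusMeasure n
      map_add' := fun f g => by
        simp only [ContinuousMap.add_apply, mul_add]
        exact integral_add (hint f) (hint g)
      map_smul' := fun c f => by
        simp only [ContinuousMap.smul_apply, smul_eq_mul, RingHom.id_apply, mul_left_comm _ c]
        exact integral_const_mul _ _ }
  let T' : C(Torus n, ℂ) →L[ℂ] ℂ := T.mkContinuous (∫ w, ‖h w‖ ∂torusMeasure n) fun f => by
    rw [← integral_mul_const]
    refine (norm_integral_le_integral_norm _).trans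
      (integral_mono (hint f).norm (hh.norm.mul_const _) fun w => ?_)
    simp only [norm_mul]
    gcongr
    exact f.norm_coe_le_norm w
  have hT : T' = 0 := by
    refine ContinuousLinearMap.ext_on (s := Set.range (UnitAddTorus.mFourier (d := Fin n))) ?_ ?_
    · rw [Submodule.dense_iff_topologicalClosure_eq_top]
      exact UnitAddTorus.span_mFourier_closure_eq_top
    · rintro _ ⟨j, rfl⟩
      have := h0 (-j)
      simpa [← UnitAddTorus.mFourier_neg] using! this
  exact DFunLike.congr_fun hT f

/-- If the right side is finite, the Fourier series converges uniformly to a continuous function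
with the coefficients of `h`, which equals `h` almost everywhere by uniqueness. -/
theorem ae_enorm_le_tsum_fourier {h : Torus n → ℂ} (hh : Integrable h (torusMeasure n)) :
    ∀ᵐ w ∂torusMeasure n, ‖h w‖ₑ ≤
      ∑' j, ‖∫ w, h w * conj (UnitAddTorus.mFourier j w) ∂torusMeasure n‖ₑ := by
  set a : IntVec n → ℂ := fun j => ∫ w, h w * conj (UnitAddTorus.mFourier j w) ∂torusMeasure n
  by_cases ht : ∑' j, ‖a j‖ₑ = ⊤
  · exact .of_forall fun w => by rw [ht]; exact le_top
  have ha : Summable fun j => ‖a j‖ := by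
    have := ENNReal.summable_toReal ht
    simpa using this
  have hc : Continuous fun w => ∑' k, a k * UnitAddTorus.mFourier k w :=
    continuous_tsum (fun k => by have := continuous_mFourier k; fun_prop) ha fun k x => by simp
  have hci : Integrable (fun w => ∑' k, a k * UnitAddTorus.mFourier k w) (torusMeasure n) :=
    hc.integrable_of_hasCompactSupport (HasCompactSupport.of_compactSpace _)
  have := ae_eq_zero_of_fourier_eq_zero (hh.sub hci) fun j => by
    simp only [Pi.sub_apply, sub_mul]
    have hj := continuous_mFourier j
    rw [integral_sub, integral_tsum_mFourier ha, sub_self]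
    · exact hh.mul_bdd (c := 1) (Continuous.aestronglyMeasurable (by fun_prop))
        (.of_forall fun w => by simp)
    · exact hci.mul_bdd (c := 1) (Continuous.aestronglyMeasurable (by fun_prop))
        (.of_forall fun w => by simp)
  filter_upwards [this] with w hw
  rw [Pi.sub_apply, Pi.zero_apply, sub_eq_zero] at hw
  rw [hw]
  refine (enorm_tsum_le_tsum_enorm ).trans (ENNReal.tsum_le_tsum fun k => ?_)
  simp [enorm_mul, a]

/-! ### The `M¹` norm on phase space controls the `L¹` norm -/

instance : SecondCountableTopology UnitAddCircle :=
  inferInstanceAs (SecondCountableTopology (ℝ ⧸ AddSubgroup.zmultiples (1 : ℝ)))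

@[simp] theorem norm_phaseChar (ζ x : Phase n) : ‖phaseChar ζ x‖ = 1 := by
  simp [phaseChar]

theorem continuous_phase {E : Type*} [TopologicalSpace E] {f : Phase n → E}
    (hf : ∀ l, Continuous fun w => f (l, w)) : Continuous f :=
  continuous_prod_of_discrete_left.2 hf

theorem continuous_phaseChar (ζ : Phase n) : Continuous (phaseChar ζ) := by
  refine continuous_phase fun l => ?_
  have := continuous_mFourier ζ.1
  simp only [phaseChar]
  fun_prop

/-- Inversion in two stages: a slice is bounded by the sum of its torus coefficients, and each of
these is in turn a Fourier coefficient, in `ξ`, of the full transform. -/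
theorem ae_enorm_le_lintegral_fourier {H : Phase n → ℂ} (hH : Integrable H (phaseMeasure n)) :
    ∀ᵐ x ∂phaseMeasure n, ‖H x‖ₑ ≤
      ∫⁻ ζ, ‖∫ x, H x * conj (phaseChar ζ x) ∂phaseMeasure n‖ₑ ∂phaseMeasure n := by
  refine ae_phase_iff.2 fun l => ?_
  filter_upwards [ae_enorm_le_tsum_fourier (integrable_slice hH l)] with w hw
  refine hw.trans ?_
  rw [lintegral_phase]
  refine ENNReal.tsum_le_tsum fun j => ?_
  set c : IntVec n → ℂ := fun l =>
    ∫ y, H (l, y) * conj (UnitAddTorus.mFourier j y) ∂torusMeasure n with hc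
  have hcs : Summable fun l => ‖conj (c l)‖ := by
    simp only [RCLike.norm_conj]
    refine Summable.of_nonneg_of_le (fun _ => norm_nonneg _) (fun l => ?_)
      (hasSum_integral_phase hH.norm).summable
    refine (norm_integral_le_integral_norm _).trans_eq ?_
    simp
  -- The conjugate turns the transform in `ξ` into a series in the characters `mFourier l`, from
  -- which `integral_tsum_mFourier` reads off `c l`.
  have hfour : ∀ ξ, conj (∫ x, H x * conj (phaseChar (j, ξ) x) ∂phaseMeasure n) =
      ∑' l, conj (c l) * UnitAddTorus.mFourier l ξ := fun ξ => by
    have hi : Integrable (fun x => H x * conj (phaseChar (j, ξ) x)) (phaseMeasure n) := by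
      have := continuous_phaseChar (j, ξ)
      exact hH.mul_bdd (c := 1) (Continuous.aestronglyMeasurable (by fun_prop))
        (.of_forall fun w => by simp)
    rw [← (hasSum_integral_phase hi).tsum_eq, Complex.conj_tsum]
    refine tsum_congr fun l => ?_
    simp only [phaseChar, map_mul, hc, mul_left_comm (H _), integral_const_mul]
    rw [Complex.conj_conj, mul_comm]
  have h1 := integral_tsum_mFourier hcs l
  simp_rw [← hfour] at h1
  calc ‖c l‖ₑ = ‖conj (c l)‖ₑ := by simp [← ofReal_norm]
    _ ≤ _ := by
      rw [← h1]
      refine (enorm_integral_le_lintegral_enorm _).trans_eq ?_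
      simp [← ofReal_norm]

/-- Peetre's inequality: the weights are submultiplicative, so the decay of a window survives
translation. -/
theorem one_add_norm_le (a b : IntVec n) : 1 + ‖a‖ ≤ (1 + ‖a - b‖) * (1 + ‖b‖) := by
  have : ‖a‖ ≤ ‖a - b‖ + ‖b‖ := norm_le_norm_sub_add a b
  nlinarith [mul_nonneg (norm_nonneg (a - b)) (norm_nonneg b)]

theorem isOpenQuotientMap_coe_torus :
    IsOpenQuotientMap fun (x : Fin n → ℝ) => (fun i => (x i : UnitAddCircle) : Torus n) :=
  IsOpenQuotientMap.piMap fun _ => QuotientAddGroup.isOpenQuotientMap_mk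

theorem IsPhaseSchwartz.continuous {Φ : Phase n → ℂ} (hΦ : IsPhaseSchwartz Φ) : Continuous Φ :=
  continuous_phase fun m =>
    isOpenQuotientMap_coe_torus.isQuotientMap.continuous_iff.2 (hΦ.1 m).continuous

theorem IsPhaseSchwartz.decay {Φ : Phase n → ℂ} (hΦ : IsPhaseSchwartz Φ) (N : ℕ) :
    ∃ C : ℝ, ∀ z, (1 + ‖z.1‖) ^ N * ‖Φ z‖ ≤ C := by
  obtain ⟨C, hC⟩ := hΦ.2 N 0
  refine ⟨C, fun ⟨m, w⟩ => ?_⟩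
  obtain ⟨x, rfl⟩ := isOpenQuotientMap_coe_torus.surjective w
  simpa [liftSlice] using hC m x

theorem aestronglyMeasurable_of_isPhaseTempered {F : Phase n → ℂ} (hF : IsPhaseTempered F) :
    AEStronglyMeasurable F (phaseMeasure n) := by
  obtain ⟨N, hN⟩ := hF
  have hc : Continuous fun z : Phase n => (1 + ‖z.1‖) ^ N := by fun_prop
  refine (hc.aestronglyMeasurable.smul hN.1).congr (.of_forall fun z => ?_)
  have : (1 + ‖z.1‖) ^ N ≠ 0 := by positivity
  rw [Pi.smul_apply', smul_smul, mul_inv_cancel₀ this, one_smul]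

theorem integrable_mul_translate {Φ F : Phase n → ℂ} (hΦ : IsPhaseSchwartz Φ)
    (hF : IsPhaseTempered F) (z : Phase n) :
    Integrable (fun x => F x * conj (Φ (x - z))) (phaseMeasure n) := by
  have hm := aestronglyMeasurable_of_isPhaseTempered hF
  obtain ⟨N, hN⟩ := hF
  obtain ⟨C, hC⟩ := hΦ.decay N
  have hcont := hΦ.continuous
  have hC0 : 0 ≤ C := le_trans (by positivity) (hC 0)
  refine (hN.norm.const_mul (C * (1 + ‖z.1‖) ^ N)).mono'
    (hm.mul (Continuous.aestronglyMeasurable (by fun_prop))) (.of_forall fun x => ?_)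
  rw [norm_mul, RCLike.norm_conj, norm_smul, Real.norm_of_nonneg (by positivity)]
  have h1 := hC (x - z)
  have h2 : (1 + ‖x.1‖) ^ N ≤ (1 + ‖x.1 - z.1‖) ^ N * (1 + ‖z.1‖) ^ N := by
    rw [← mul_pow]
    exact pow_le_pow_left₀ (by positivity) (one_add_norm_le _ _) _
  have h3 : ‖Φ (x - z)‖ ≤ C * (1 + ‖z.1‖) ^ N * ((1 + ‖x.1‖) ^ N)⁻¹ := by
    rw [← div_eq_mul_inv, le_div_iff₀ (by positivity)]
    calc ‖Φ (x - z)‖ * (1 + ‖x.1‖) ^ N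
        ≤ ‖Φ (x - z)‖ * ((1 + ‖x.1 - z.1‖) ^ N * (1 + ‖z.1‖) ^ N) := by gcongr
      _ = ((1 + ‖(x - z).1‖) ^ N * ‖Φ (x - z)‖) * (1 + ‖z.1‖) ^ N := by
          rw [Prod.fst_sub]; ring
      _ ≤ _ := by gcongr
  calc ‖F x‖ * ‖Φ (x - z)‖ ≤ ‖F x‖ * (C * (1 + ‖z.1‖) ^ N * ((1 + ‖x.1‖) ^ N)⁻¹) := by gcongr
    _ = _ := by ring

theorem ae_enorm_mul_le_lintegral_phaseStft {Φ F : Phase n → ℂ} (hΦ : IsPhaseSchwartz Φ)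
    (hF : IsPhaseTempered F) (z : Phase n) :
    ∀ᵐ x ∂phaseMeasure n, ‖F x‖ₑ * ‖Φ (x - z)‖ₑ ≤
      ∫⁻ ζ, ‖phaseStft Φ F z ζ‖ₑ ∂phaseMeasure n := by
  filter_upwards [ae_enorm_le_lintegral_fourier (integrable_mul_translate hΦ hF z)] with x hx
  have h : ∀ ζ, phaseStft Φ F z ζ =
      ∫ x, F x * conj (Φ (x - z)) * conj (phaseChar ζ x) ∂phaseMeasure n := fun ζ => by
    simp only [phaseStft, map_mul, mul_assoc, mul_comm (conj (phaseChar _ _))]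
  simp_rw [h]
  refine le_trans (le_of_eq ?_) hx
  simp [← ofReal_norm]

instance : (phaseMeasure n).IsOpenPosMeasure := by
  have : (Measure.count : Measure (IntVec n)).IsOpenPosMeasure :=
    ⟨fun U _ hU => Measure.count_ne_zero_iff.2 hU⟩
  unfold phaseMeasure; infer_instance

instance : SFinite (phaseMeasure n) := by
  unfold phaseMeasure; infer_instance

instance : (torusMeasure n).IsNegInvariant := by
  have : (AddCircle.haarAddCircle : Measure UnitAddCircle).IsNegInvariant := inferInstance
  unfold torusMeasure; infer_instance

theorem lintegral_phase_sub_right (f : Phase n → ℝ≥0∞) (z : Phase n) :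
    ∫⁻ x, f (x - z) ∂phaseMeasure n = ∫⁻ x, f x ∂phaseMeasure n := by
  rw [lintegral_phase, lintegral_phase, ← (Equiv.subRight z.1).tsum_eq fun l => ∫⁻ w, f (l, w) ∂torusMeasure n]
  exact tsum_congr fun l => lintegral_sub_right_eq_self (fun w => f (l - z.1, w)) z.2

theorem lintegral_phase_sub_left (f : Phase n → ℝ≥0∞) (x : Phase n) :
    ∫⁻ z, f (x - z) ∂phaseMeasure n = ∫⁻ z, f z ∂phaseMeasure n := by
  rw [lintegral_phase, lintegral_phase, ← (Equiv.subLeft x.1).tsum_eq fun l => ∫⁻ w, f (l, w) ∂torusMeasure n]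
  exact tsum_congr fun l => lintegral_sub_left_eq_self (fun w => f (x.1 - l, w)) x.2

theorem phaseMeasure_fst_singleton (m : IntVec n) :
    phaseMeasure n {x | x.1 = m} = 1 := by
  have hm : MeasurableSet {x : Phase n | x.1 = m} :=
    (MeasurableSet.singleton m).preimage measurable_fst
  rw [← lintegral_indicator_one hm,
    lintegral_phase, tsum_eq_single m]
  · simp
  · intro l hl
    simp [hl]

/-- The pointwise bound is multiplied by the indicator of `x - z ∈ U`, where `U` is a neighbourhood
of `z₀` on which `|Φ| > c`, and integrated in `x` and `z`. Both sides acquire the factor `μ(U)`,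
which cancels. Localising to `U` keeps the exact constant `|Φ(z₀)|`, which is what permits `C = 1`.
-/
theorem enorm_mul_lintegral_le_phaseM1Norm {Φ F : Phase n → ℂ} (hΦ : IsPhaseSchwartz Φ)
    (hF : IsPhaseTempered F) (z₀ : Phase n) :
    ‖Φ z₀‖ₑ * ∫⁻ x, ‖F x‖ₑ ∂phaseMeasure n ≤ phaseM1Norm Φ F := by
  have hcont := hΦ.continuous
  have hFm := (aestronglyMeasurable_of_isPhaseTempered hF).enorm
  have key : ∀ c < ‖Φ z₀‖ₑ, c * ∫⁻ x, ‖F x‖ₑ ∂phaseMeasure n ≤ phaseM1Norm Φ F := by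
    intro c hc
    -- Intersecting with a single slice makes the measure of `U` finite; openness makes it positive.
    set U : Set (Phase n) := {x | c < ‖Φ x‖ₑ} ∩ {x | x.1 = z₀.1} with hU
    have hUo : IsOpen U := (isOpen_lt continuous_const hcont.enorm).inter
      ((isOpen_discrete {z₀.1}).preimage continuous_fst)
    have hU0 : phaseMeasure n U ≠ 0 := (hUo.measure_pos _ ⟨z₀, hc, rfl⟩).ne'
    have hU1 : phaseMeasure n U ≠ ⊤ :=
      ((measure_mono Set.inter_subset_right).trans_lt
        ((phaseMeasure_fst_singleton z₀.1).trans_lt ENNReal.one_lt_top)).ne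
    set h : Phase n → ℝ≥0∞ := U.indicator 1 with hh
    have hhm : Measurable h := measurable_one.indicator hUo.measurableSet
    have hint : ∫⁻ x, h x ∂phaseMeasure n = phaseMeasure n U :=
      lintegral_indicator_one hUo.measurableSet
    have hlow : c * phaseMeasure n U ≤ ∫⁻ x, ‖Φ x‖ₑ * h x ∂phaseMeasure n := by
      rw [← hint, ← lintegral_const_mul _ hhm]
      refine lintegral_mono fun x => ?_
      by_cases hx : x ∈ U
      · exact mul_le_mul_left hx.1.le _
      · simp [hh, hx]
    have hΦm : Measurable fun x => ‖Φ x‖ₑ * h x := hcont.enorm.measurable.mul hhm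
    have hswap : ∫⁻ z, ∫⁻ x, ‖F x‖ₑ * (‖Φ (x - z)‖ₑ * h (x - z)) ∂phaseMeasure n ∂phaseMeasure n =
        (∫⁻ x, ‖F x‖ₑ ∂phaseMeasure n) * ∫⁻ x, ‖Φ x‖ₑ * h x ∂phaseMeasure n := by
      rw [lintegral_lintegral_swap]
      · rw [← lintegral_mul_const'' _ hFm]
        refine lintegral_congr fun x => ?_
        have hm : Measurable fun z => ‖Φ (x - z)‖ₑ * h (x - z) :=
          hΦm.comp (measurable_id.const_sub x)
        rw [lintegral_const_mul _ hm, lintegral_phase_sub_left (fun x => ‖Φ x‖ₑ * h x)]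
      · refine AEMeasurable.mul ?_ ?_
        · exact hFm.comp_quasiMeasurePreserving Measure.quasiMeasurePreserving_snd
        · exact (hΦm.comp (measurable_snd.sub measurable_fst)).aemeasurable
    have hup : ∫⁻ z, ∫⁻ x, ‖F x‖ₑ * (‖Φ (x - z)‖ₑ * h (x - z)) ∂phaseMeasure n ∂phaseMeasure n ≤
        phaseM1Norm Φ F * phaseMeasure n U := by
      rw [phaseM1Norm, ← lintegral_mul_const' _ _ hU1]
      refine lintegral_mono fun z => ?_
      have hm : Measurable fun x => h (x - z) := hhm.comp (measurable_id.sub_const z)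
      rw [← hint, ← lintegral_phase_sub_right h z, ← lintegral_const_mul _ hm]
      refine lintegral_mono_ae ?_
      filter_upwards [ae_enorm_mul_le_lintegral_phaseStft hΦ hF z] with x hx
      rw [← mul_assoc]
      exact mul_le_mul_left hx _
    rw [hswap] at hup
    refine (ENNReal.mul_le_mul_iff_left hU0 hU1).1 (le_trans ?_ hup)
    rw [mul_right_comm, mul_comm]
    exact mul_le_mul_right hlow _
  -- Let `c` increase to `‖Φ z₀‖ₑ`.
  refine ENNReal.mul_le_of_forall_lt fun a ha b hb => (mul_le_mul_right hb.le a).trans (key a ha)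

/-! ### The `M¹` norm on the lattice controls the `ℓ¹` norm -/

theorem summable_prod_of_summable {a : ℤ → ℝ} (ha : Summable a) (ha0 : ∀ k, 0 ≤ a k) (n : ℕ) :
    Summable fun k : IntVec n => ∏ i, a (k i) := by
  induction n with
  | zero => exact (hasSum_fintype _).summable
  | succ n ih =>
    rw [← (Fin.consEquiv fun _ => ℤ).summable_iff]
    have := ha.mul_of_nonneg ih ha0 (fun _ => Finset.prod_nonneg fun _ _ => ha0 _)
    refine this.congr fun p => ?_
    simp [Fin.prod_univ_succ]

/-- In the sup norm `∏ (1 + |kᵢ|) ≤ (1 + ‖k‖)ⁿ`, so the series is dominated by a product of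
one-dimensional convergent ones. -/
theorem summable_inv_one_add_norm_pow (n : ℕ) :
    Summable fun k : IntVec n => ((1 + ‖k‖) ^ (2 * n))⁻¹ := by
  have h1 : Summable fun k : ℤ => ((1 + |(k : ℝ)|) ^ 2)⁻¹ := by
    refine ((Real.summable_one_div_int_add_rpow 0 2).2 one_lt_two).of_norm_bounded_eventually ?_
    filter_upwards [Set.Finite.compl_mem_cofinite (Set.finite_singleton (0 : ℤ))] with k hk
    have hk0 : (0 : ℝ) < |(k : ℝ)| := by simpa using hk
    rw [Real.norm_of_nonneg (by positivity), add_zero, ← one_div, Real.rpow_two]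
    gcongr
    simp
  refine (summable_prod_of_summable h1 (fun _ => by positivity) n).of_nonneg_of_le
    (fun _ => by positivity) fun k => ?_
  rw [Finset.prod_inv_distrib, Finset.prod_pow, pow_mul']
  have : ∏ i, (1 + |(k i : ℝ)|) ≤ (1 + ‖k‖) ^ n := by
    refine (Finset.prod_le_prod (fun _ _ => by positivity)
      (fun i _ => add_le_add_right (norm_le_pi_norm k i) 1)).trans_eq ?_
    simp
  gcongr

theorem summable_mul_translate {φ g : IntVec n → ℂ} (hφ : IsSchwartz φ) (hg : IsTempered g)
    (m : IntVec n) : Summable fun k => ‖g k * conj (φ (k - m))‖ := by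
  obtain ⟨N, C, hC⟩ := hg
  obtain ⟨D, hD⟩ := hφ (N + 2 * n)
  have hC0 : 0 ≤ C := by simpa using (norm_nonneg _).trans (hC 0)
  refine ((summable_inv_one_add_norm_pow n).mul_left
    (C * (D * (1 + ‖m‖) ^ (N + 2 * n)))).of_nonneg_of_le (fun _ => norm_nonneg _) fun k => ?_
  rw [norm_mul, RCLike.norm_conj, ← div_eq_mul_inv, le_div_iff₀ (by positivity)]
  have h2 : (1 + ‖k‖) ^ (N + 2 * n) ≤
      (1 + ‖k - m‖) ^ (N + 2 * n) * (1 + ‖m‖) ^ (N + 2 * n) := by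
    rw [← mul_pow]
    exact pow_le_pow_left₀ (by positivity) (one_add_norm_le _ _) _
  calc ‖g k‖ * ‖φ (k - m)‖ * (1 + ‖k‖) ^ (2 * n)
      ≤ C * (1 + ‖k‖) ^ N * ‖φ (k - m)‖ * (1 + ‖k‖) ^ (2 * n) := by gcongr; exact hC k
    _ = C * (‖φ (k - m)‖ * (1 + ‖k‖) ^ (N + 2 * n)) := by ring
    _ ≤ C * (‖φ (k - m)‖ * ((1 + ‖k - m‖) ^ (N + 2 * n) * (1 + ‖m‖) ^ (N + 2 * n))) := by gcongr
    _ = C * (((1 + ‖k - m‖) ^ (N + 2 * n) * ‖φ (k - m)‖) * (1 + ‖m‖) ^ (N + 2 * n)) := by ring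
    _ ≤ _ := by gcongr; exact hD _

/-- For fixed `m`, the conjugate of `V_φ g(m, ·)` is an absolutely convergent trigonometric series
whose `k`-th coefficient has modulus `|φ(k-m) g(k)|`. -/
theorem enorm_mul_le_lintegral_stft {φ g : IntVec n → ℂ} (hφ : IsSchwartz φ) (hg : IsTempered g)
    (m k : IntVec n) :
    ‖φ (k - m)‖ₑ * ‖g k‖ₑ ≤ ∫⁻ w, ‖stft φ g (m, w)‖ₑ ∂torusMeasure n := by
  have hs : Summable fun k => ‖conj (g k * conj (φ (k - m)))‖ := by
    simpa only [RCLike.norm_conj] using summable_mul_translate hφ hg m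
  have h := integral_tsum_mFourier hs k
  have h1 : ∀ w, ∑' k, conj (g k * conj (φ (k - m))) * UnitAddTorus.mFourier k w =
      conj (stft φ g (m, w)) := fun w => by
    rw [stft, pairing, Complex.conj_tsum]
    refine tsum_congr fun l => ?_
    simp only [tfShift, map_mul, Complex.conj_conj]
    ring
  simp_rw [h1] at h
  calc ‖φ (k - m)‖ₑ * ‖g k‖ₑ = ‖conj (g k * conj (φ (k - m)))‖ₑ := by
        simp [← ofReal_norm, mul_comm]
    _ ≤ _ := by
      rw [← h]
      refine (enorm_integral_le_lintegral_enorm _).trans_eq ?_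
      simp [← ofReal_norm]

/-- For each `m` only the coefficient at `k = m + k₀` is kept. -/
theorem enorm_mul_tsum_le_m1Norm {φ g : IntVec n → ℂ} (hφ : IsSchwartz φ) (hg : IsTempered g)
    (k₀ : IntVec n) : ‖φ k₀‖ₑ * ∑' k, ‖g k‖ₑ ≤ m1Norm φ g := by
  rw [← ENNReal.tsum_mul_left, ← (Equiv.addRight k₀).tsum_eq]
  refine ENNReal.tsum_le_tsum fun m => ?_
  simpa using enorm_mul_le_lintegral_stft hφ hg m (m + k₀)

/-! ### Decay of Fourier coefficients -/

/-- The `j`-th Fourier coefficient of a function on the torus. -/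
def torusCoeff (u : Torus n → ℂ) (j : IntVec n) : ℂ :=
  ∫ w, u w * conj (UnitAddTorus.mFourier j w) ∂torusMeasure n

/-- The projection `ℝⁿ → 𝕋ⁿ`. -/
def toTorus (x : Fin n → ℝ) : Torus n := fun i => (x i : UnitAddCircle)

/-- The derivative of a function on the torus in the direction of the `i`-th coordinate. -/
def torusDeriv (i : Fin n) (u : Torus n → ℂ) (w : Torus n) : ℂ :=
  deriv (fun h : ℝ => u (w + toTorus (h • Pi.single i 1))) 0

theorem toTorus_add (x y : Fin n → ℝ) : toTorus (x + y) = toTorus x + toTorus y := by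
  ext i; simp [toTorus]

theorem toTorus_surjective : Function.Surjective (toTorus (n := n)) :=
  isOpenQuotientMap_coe_torus.surjective

theorem continuous_of_contDiff_toTorus {u : Torus n → ℂ}
    (hu : ContDiff ℝ ∞ fun x => u (toTorus x)) : Continuous u :=
  isOpenQuotientMap_coe_torus.isQuotientMap.continuous_iff.2 hu.continuous

theorem hasDerivAt_translate {u : Torus n → ℂ} (hu : ContDiff ℝ ∞ fun x => u (toTorus x))
    (i : Fin n) (x : Fin n → ℝ) (h : ℝ) :
    HasDerivAt (fun h : ℝ => u (toTorus x + toTorus (h • Pi.single i 1)))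
      (fderiv ℝ (fun x => u (toTorus x)) (x + h • Pi.single i 1) (Pi.single i 1)) h := by
  simp_rw [← toTorus_add]
  have h1 : HasDerivAt (fun h : ℝ => x + h • (Pi.single i 1 : Fin n → ℝ)) (Pi.single i 1) h := by
    simpa using ((hasDerivAt_id h).smul_const (Pi.single i 1 : Fin n → ℝ)).const_add x
  exact ((hu.differentiable (by simp) _).hasFDerivAt).comp_hasDerivAt h h1

theorem torusDeriv_toTorus {u : Torus n → ℂ} (hu : ContDiff ℝ ∞ fun x => u (toTorus x))
    (i : Fin n) (x : Fin n → ℝ) :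
    torusDeriv i u (toTorus x) = fderiv ℝ (fun x => u (toTorus x)) x (Pi.single i 1) := by
  simpa [torusDeriv] using (hasDerivAt_translate hu i x 0).deriv

theorem contDiff_torusDeriv {u : Torus n → ℂ} (hu : ContDiff ℝ ∞ fun x => u (toTorus x))
    (i : Fin n) : ContDiff ℝ ∞ fun x => torusDeriv i u (toTorus x) := by
  simp_rw [torusDeriv_toTorus hu]
  exact (hu.fderiv_right (by simp)).clm_apply contDiff_const

theorem hasDerivAt_torus {u : Torus n → ℂ} (hu : ContDiff ℝ ∞ fun x => u (toTorus x))
    (i : Fin n) (w : Torus n) (h : ℝ) :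
    HasDerivAt (fun h : ℝ => u (w + toTorus (h • Pi.single i 1)))
      (torusDeriv i u (w + toTorus (h • Pi.single i 1))) h := by
  obtain ⟨x, rfl⟩ := toTorus_surjective w
  rw [← toTorus_add, torusDeriv_toTorus hu]
  exact hasDerivAt_translate hu i x h

theorem torusCoeff_translate (u : Torus n → ℂ) (v : Torus n) (j : IntVec n) :
    ∫ w, u (w + v) * conj (UnitAddTorus.mFourier j w) ∂torusMeasure n =
      UnitAddTorus.mFourier j v * torusCoeff u j := by
  rw [torusCoeff, ← integral_add_right_eq_self
    (fun w => u w * conj (UnitAddTorus.mFourier j w)) v, ← integral_const_mul]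
  refine integral_congr_ae (.of_forall fun w => ?_)
  have : UnitAddTorus.mFourier j v * conj (UnitAddTorus.mFourier j v) = 1 := by
    rw [RCLike.mul_conj]; simp
  simp only [mFourier_apply_add, map_mul]
  linear_combination (-(u (w + v) * conj (UnitAddTorus.mFourier j w))) * this

theorem mFourier_toTorus_single (j : IntVec n) (i : Fin n) (h : ℝ) :
    UnitAddTorus.mFourier j (toTorus (h • Pi.single i 1)) = fourier (j i) (h : UnitAddCircle) := by
  simp only [UnitAddTorus.mFourier, ContinuousMap.coe_mk, toTorus, Pi.smul_apply, smul_eq_mul]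
  rw [Finset.prod_eq_single i]
  · simp
  · intro b _ hb
    rw [Pi.single_eq_of_ne hb, mul_zero, AddCircle.coe_zero, fourier_eval_zero]
  · simp

/-- Translating `u` multiplies its coefficient by a character; differentiating this identity at zero
translation replaces integration by parts. -/
theorem torusCoeff_torusDeriv {u : Torus n → ℂ} (hu : ContDiff ℝ ∞ fun x => u (toTorus x))
    (i : Fin n) (j : IntVec n) :
    torusCoeff (torusDeriv i u) j = 2 * Real.pi * Complex.I * j i * torusCoeff u j := by
  have huc := continuous_of_contDiff_toTorus hu
  have hdc := continuous_of_contDiff_toTorus (contDiff_torusDeriv hu i)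
  have hj := continuous_mFourier j
  obtain ⟨B, hB⟩ := isCompact_univ.exists_bound_of_continuousOn hdc.continuousOn
  have h1 := (hasDerivAt_integral_of_dominated_loc_of_deriv_le (μ := torusMeasure n)
    (F := fun (h : ℝ) w => u (w + toTorus (h • Pi.single i 1)) * conj (UnitAddTorus.mFourier j w))
    (F' := fun (h : ℝ) w => torusDeriv i u (w + toTorus (h • Pi.single i 1)) *
      conj (UnitAddTorus.mFourier j w)) (x₀ := 0) (bound := fun _ => B)
    Filter.univ_mem (.of_forall fun h => Continuous.aestronglyMeasurable (by fun_prop))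
    (Continuous.integrable_of_hasCompactSupport (by fun_prop)
      (HasCompactSupport.of_compactSpace _))
    (Continuous.aestronglyMeasurable (by fun_prop))
    (.of_forall fun w h _ => by simpa using hB _ (Set.mem_univ _))
    (integrable_const _)
    (.of_forall fun w h _ => (hasDerivAt_torus hu i w h).mul_const _)).2
  simp_rw [torusCoeff_translate, mFourier_toTorus_single] at h1
  have h2 := (hasDerivAt_fourier 1 (j i) 0).mul_const (torusCoeff u j)
  have h3 := h1.unique h2
  simpa using h3

theorem torusDeriv_iterate {u : Torus n → ℂ} (hu : ContDiff ℝ ∞ fun x => u (toTorus x))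
    (i : Fin n) (r : ℕ) :
    ContDiff ℝ ∞ (fun x => (torusDeriv i)^[r] u (toTorus x)) ∧
    (∀ x, (torusDeriv i)^[r] u (toTorus x) =
      iteratedFDeriv ℝ r (fun x => u (toTorus x)) x fun _ => Pi.single i 1) ∧
    ∀ j : IntVec n, torusCoeff ((torusDeriv i)^[r] u) j =
      (2 * Real.pi * Complex.I * j i) ^ r * torusCoeff u j := by
  induction r with
  | zero => simpa using hu
  | succ r ih =>
    obtain ⟨h1, h2, h3⟩ := ih
    simp only [Function.iterate_succ_apply']
    refine ⟨contDiff_torusDeriv h1 i, fun x => ?_, fun j => ?_⟩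
    · rw [torusDeriv_toTorus h1, iteratedFDeriv_succ_apply_left, funext h2]
      have hd : DifferentiableAt ℝ (iteratedFDeriv ℝ r fun x => u (toTorus x)) x :=
        (hu.differentiable_iteratedFDeriv (by exact_mod_cast ENat.natCast_lt_top r)) x
      rw [(hd.hasFDerivAt.continuousMultilinear_apply_const _).fderiv]
      rfl
    · rw [torusCoeff_torusDeriv h1, h3, pow_succ]
      ring

theorem norm_pow_mul_torusCoeff_le {u : Torus n → ℂ} (hu : ContDiff ℝ ∞ fun x => u (toTorus x))
    {r : ℕ} {B : ℝ} (hB : ∀ x, ‖iteratedFDeriv ℝ r (fun x => u (toTorus x)) x‖ ≤ B)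
    (i : Fin n) (j : IntVec n) : |(j i : ℝ)| ^ r * ‖torusCoeff u j‖ ≤ B := by
  obtain ⟨-, h2, h3⟩ := torusDeriv_iterate hu i r
  have hle : ∀ w, ‖(torusDeriv i)^[r] u w‖ ≤ B := fun w => by
    obtain ⟨x, rfl⟩ := toTorus_surjective w
    rw [h2]
    refine (ContinuousMultilinearMap.le_opNorm _ _).trans ?_
    have h1 : ‖(Pi.single i 1 : Fin n → ℝ)‖ = 1 := by rw [Pi.norm_single, norm_one]
    simpa only [h1, Finset.prod_const_one, mul_one] using hB x
  have h4 : ‖torusCoeff ((torusDeriv i)^[r] u) j‖ ≤ B := by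
    refine (norm_integral_le_of_norm_le_const (C := B) (.of_forall fun w => ?_)).trans_eq ?_
    · simpa using hle w
    · simp
  rw [h3, norm_mul, norm_pow] at h4
  refine le_trans ?_ h4
  gcongr
  simp only [norm_mul, Complex.norm_I, mul_one, Complex.norm_intCast, Complex.norm_real]
  -- Each derivative gains a factor `2π|jᵢ|`, and `2π ≥ 1` is discarded.
  have : (1 : ℝ) ≤ ‖(2 : ℂ)‖ * ‖Real.pi‖ := by
    rw [Real.norm_of_nonneg Real.pi_pos.le]
    norm_num
    linarith [Real.pi_gt_three]
  exact le_mul_of_one_le_left (abs_nonneg _) this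

theorem norm_torusCoeff_le {u : Torus n → ℂ} {B : ℝ} (hB : ∀ w, ‖u w‖ ≤ B) (j : IntVec n) :
    ‖torusCoeff u j‖ ≤ B := by
  refine (norm_integral_le_of_norm_le_const (C := B) (.of_forall fun w => ?_)).trans_eq ?_
  · simpa using hB w
  · simp

theorem exists_abs_apply_eq_norm (hn : 0 < n) (j : IntVec n) : ∃ i, |(j i : ℝ)| = ‖j‖ := by
  have : Nonempty (Fin n) := ⟨⟨0, hn⟩⟩
  obtain ⟨i, hi⟩ := Finite.exists_max fun i => ‖j i‖
  exact ⟨i, le_antisymm (norm_le_pi_norm j i) ((pi_norm_le_iff_of_nonneg (norm_nonneg _)).2 hi)⟩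

/-- The Wiener norm: the sum over the lattice of the `ℓ¹` norms of the Fourier coefficients of the
slices. -/
def wienerNorm (Φ : Phase n → ℂ) : ℝ≥0∞ :=
  ∑' m : IntVec n, ∑' j : IntVec n, ‖torusCoeff (fun w => Φ (m, w)) j‖ₑ

/-- The sup bound handles small `j` and derivatives of order `2n` handle large `j`; the exponent
`2n` is the one for which the weights are summable over `ℤⁿ`. -/
theorem IsPhaseSchwartz.exists_norm_torusCoeff_le {Φ : Phase n → ℂ} (hΦ : IsPhaseSchwartz Φ) :
    ∃ K : ℝ, ∀ m j, ‖torusCoeff (fun w => Φ (m, w)) j‖ ≤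
      K * (((1 + ‖m‖) ^ (2 * n))⁻¹ * ((1 + ‖j‖) ^ (2 * n))⁻¹) := by
  obtain ⟨C₀, hC₀⟩ := hΦ.decay (2 * n)
  obtain ⟨C₁, hC₁⟩ := hΦ.2 (2 * n) (2 * n)
  refine ⟨2 ^ (2 * n) * (C₀ + C₁), fun m j => ?_⟩
  set c := ‖torusCoeff (fun w => Φ (m, w)) j‖ with hc
  set M := (1 + ‖m‖) ^ (2 * n) with hM
  have hMpos : 0 < M := by positivity
  have h0 : c ≤ C₀ / M := norm_torusCoeff_le (fun w => by
    rw [le_div_iff₀ hMpos, mul_comm]; exact hC₀ (m, w)) j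
  have hC1 : 0 ≤ C₁ := le_trans (by positivity) (hC₁ m 0)
  have h1 : ‖j‖ ^ (2 * n) * c ≤ C₀ / M + C₁ / M := by
    -- For `n = 0` there is no coordinate to differentiate in, but the power is `1` and the sup
    -- bound suffices.
    rcases Nat.eq_zero_or_pos n with hn | hn
    · subst hn
      have : 0 ≤ C₁ / M := by positivity
      simpa using h0.trans (le_add_of_nonneg_right this)
    · obtain ⟨i, hi⟩ := exists_abs_apply_eq_norm hn j
      rw [← hi]
      refine le_trans (norm_pow_mul_torusCoeff_le (B := C₁ / M) (hΦ.1 m) (fun x => ?_) i j) ?_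
      · rw [le_div_iff₀ hMpos, mul_comm]
        exact hC₁ m x
      · exact le_add_of_nonneg_left ((norm_nonneg _).trans h0)
  have h2 : c ≤ C₀ / M + C₁ / M := h0.trans (le_add_of_nonneg_right (by positivity))
  have h3 : (1 + ‖j‖) ^ (2 * n) * c ≤ 2 ^ (2 * n) * (C₀ / M + C₁ / M) := by
    rcases le_total ‖j‖ 1 with hj | hj
    · calc (1 + ‖j‖) ^ (2 * n) * c ≤ 2 ^ (2 * n) * c := by gcongr; linarith
        _ ≤ _ := by gcongr
    · calc (1 + ‖j‖) ^ (2 * n) * c ≤ (2 * ‖j‖) ^ (2 * n) * c := by gcongr; linarith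
        _ = 2 ^ (2 * n) * (‖j‖ ^ (2 * n) * c) := by rw [mul_pow, mul_assoc]
        _ ≤ _ := by gcongr
  rw [← mul_assoc, ← div_eq_mul_inv, ← div_eq_mul_inv, le_div_iff₀ (by positivity), mul_comm]
  refine h3.trans_eq ?_
  ring

theorem IsPhaseSchwartz.wienerNorm_lt_top {Φ : Phase n → ℂ} (hΦ : IsPhaseSchwartz Φ) :
    wienerNorm Φ < ⊤ := by
  obtain ⟨K, hK⟩ := hΦ.exists_norm_torusCoeff_le
  have hs := ((summable_inv_one_add_norm_pow n).mul_of_nonneg (summable_inv_one_add_norm_pow n)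
    (fun _ => by positivity) (fun _ => by positivity)).mul_left K
  have hs' : Summable fun p : IntVec n × IntVec n =>
      ‖torusCoeff (fun w => Φ (p.1, w)) p.2‖ :=
    hs.of_nonneg_of_le (fun _ => norm_nonneg _) fun p => hK p.1 p.2
  rw [wienerNorm, ← ENNReal.tsum_prod (f := fun m j => ‖torusCoeff (fun w => Φ (m, w)) j‖ₑ)]
  simp_rw [← ofReal_norm]
  rw [← ENNReal.ofReal_tsum_of_nonneg (fun _ => norm_nonneg _) hs']
  exact ENNReal.ofReal_lt_top

/-! ### Singular values and the trace norm -/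

section TraceNorm

variable {H : Type*} [NormedAddCommGroup H] [InnerProductSpace ℂ H]

/-- `finrank` is `0` on an infinite-dimensional space, where the family is empty; this matches the
convention in `traceNorm`, so no compactness is needed. -/
theorem exists_orthonormal_fin_finrank (V : Submodule ℂ H) :
    ∃ v : Fin (Module.finrank ℂ V) → V, Orthonormal ℂ v := by
  rcases Nat.eq_zero_or_pos (Module.finrank ℂ V) with h | h
  · have : IsEmpty (Fin (Module.finrank ℂ V)) := by rw [h]; infer_instance
    exact ⟨isEmptyElim, ⟨isEmptyElim, fun i => isEmptyElim i⟩⟩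
  · have := Module.finite_of_finrank_pos h
    exact ⟨stdOrthonormalBasis ℂ V, (stdOrthonormalBasis ℂ V).orthonormal⟩

variable [CompleteSpace H]

/-- The eigenspaces of `|A|` for positive eigenvalues. -/
def singularSpace (A : H →L[ℂ] H) (μ : {μ : ℝ // 0 < μ}) : Submodule ℂ H :=
  Module.End.eigenspace ((CFC.abs A : H →L[ℂ] H) : H →ₗ[ℂ] H) ((μ : ℝ) : ℂ)

theorem abs_isPositive (A : H →L[ℂ] H) : (CFC.abs A).IsPositive :=
  (ContinuousLinearMap.nonneg_iff_isPositive _).1 (CFC.abs_nonneg A)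

theorem inner_apply_apply_eq (A : H →L[ℂ] H) (x y : H) :
    inner ℂ (A x) (A y) = inner ℂ (CFC.abs A x) (CFC.abs A y) := by
  have h := CFC.abs_mul_abs A
  rw [ContinuousLinearMap.star_eq_adjoint] at h
  have hs : inner ℂ (CFC.abs A x) (CFC.abs A y) = inner ℂ x (CFC.abs A (CFC.abs A y)) :=
    (abs_isPositive A).isSymmetric x (CFC.abs A y)
  rw [hs, ← ContinuousLinearMap.adjoint_inner_right]
  exact congrArg _ (DFunLike.congr_fun h y).symm

theorem orthogonalFamily_singularSpace (A : H →L[ℂ] H) :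
    OrthogonalFamily ℂ (fun μ => singularSpace A μ) fun μ => (singularSpace A μ).subtypeₗᵢ :=
  (abs_isPositive A).isSymmetric.orthogonalFamily_eigenspaces.comp
    (γ := {μ : ℝ // 0 < μ}) (f := fun μ => ((μ : ℝ) : ℂ))
    fun _ _ h => Subtype.ext (Complex.ofReal_injective h)

theorem traceNorm_eq_tsum_pos (A : H →L[ℂ] H) :
    traceNorm A = ∑' μ : {μ : ℝ // 0 < μ},
      ENNReal.ofReal μ * (Module.finrank ℂ (singularSpace A μ) : ℝ≥0∞) := by
  rw [traceNorm]
  symm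
  refine Subtype.val_injective.tsum_eq (f := fun μ : ℝ => ENNReal.ofReal μ *
    (Module.finrank ℂ (Module.End.eigenspace
      ((CFC.abs A : H →L[ℂ] H) : H →ₗ[ℂ] H) (μ : ℂ)) : ℝ≥0∞)) fun μ hμ => ?_
  refine ⟨⟨μ, ?_⟩, rfl⟩
  by_contra hle
  exact hμ (by simp only [ENNReal.ofReal_of_nonpos (not_lt.1 hle), zero_mul])

theorem singularSpace_apply {A : H →L[ℂ] H} {μ : {μ : ℝ // 0 < μ}} {v : H}
    (hv : v ∈ singularSpace A μ) : CFC.abs A v = ((μ : ℝ) : ℂ) • v :=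
  Module.End.mem_eigenspace_iff.1 hv

/-- Indices of singular values, counted with multiplicity. -/
abbrev SingularIndex (A : H →L[ℂ] H) : Type :=
  Σ μ : {μ : ℝ // 0 < μ}, Fin (Module.finrank ℂ (singularSpace A μ))

theorem traceNorm_eq_tsum_sigma (A : H →L[ℂ] H) :
    traceNorm A = ∑' p : SingularIndex A, ENNReal.ofReal p.1 := by
  rw [traceNorm_eq_tsum_pos, ENNReal.tsum_sigma']
  refine tsum_congr fun μ => ?_
  change _ = ∑' _ : Fin (Module.finrank ℂ (singularSpace A μ)), ENNReal.ofReal μ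
  rw [tsum_fintype, Finset.sum_const, Finset.card_univ, Fintype.card_fin, nsmul_eq_mul, mul_comm]

theorem exists_orthonormal_singular (A : H →L[ℂ] H) :
    ∃ e : SingularIndex A → H, Orthonormal ℂ e ∧ (∀ i, e i ∈ singularSpace A i.1) ∧
      ∀ μ, Module.Finite ℂ (singularSpace A μ) →
        singularSpace A μ ≤ Submodule.span ℂ (Set.range e) := by
  choose v hv using fun μ => exists_orthonormal_fin_finrank (singularSpace A μ)
  refine ⟨fun p => v p.1 p.2, (orthogonalFamily_singularSpace A).orthonormal_sigma_orthonormal hv,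
    fun p => (v p.1 p.2).2, fun μ hμ => ?_⟩
  have htop : Submodule.span ℂ (Set.range (v μ)) = ⊤ :=
    (hv μ).linearIndependent.span_eq_top_of_card_eq_finrank' (by simp)
  calc singularSpace A μ = (⊤ : Submodule ℂ (singularSpace A μ)).map (singularSpace A μ).subtype :=
        (Submodule.map_subtype_top _).symm
    _ = Submodule.span ℂ ((singularSpace A μ).subtype '' Set.range (v μ)) := by
        rw [← htop, Submodule.map_span]
    _ ≤ _ := by
        refine Submodule.span_mono ?_
        rintro _ ⟨_, ⟨i, rfl⟩, rfl⟩
        exact ⟨⟨μ, i⟩, rfl⟩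

theorem inner_apply_singular (A : H →L[ℂ] H) {e : SingularIndex A → H} (he : Orthonormal ℂ e)
    (hs : ∀ i, e i ∈ singularSpace A i.1) (i j : SingularIndex A) :
    inner ℂ (A (e i)) (A (e j)) = if i = j then (((i.1 : ℝ) : ℂ)) ^ 2 else 0 := by
  rw [inner_apply_apply_eq, singularSpace_apply (hs i), singularSpace_apply (hs j),
    inner_smul_left, inner_smul_right, orthonormal_iff_ite.1 he, Complex.conj_ofReal]
  split_ifs with h
  · rw [h]; ring
  · simp

/-- Duality: for singular vectors `e` and `f = μ⁻¹ A e`, the tested sum is exactly a partial sum of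
the singular values. -/
theorem traceNorm_le (A : H →L[ℂ] H) (B : ℝ≥0∞)
    (h : ∀ (ι : Type) [Fintype ι] (e f : ι → H), Orthonormal ℂ e → Orthonormal ℂ f →
      ‖∑ i, inner ℂ (f i) (A (e i))‖ₑ ≤ B) : traceNorm A ≤ B := by
  obtain ⟨e, he, hs, -⟩ := exists_orthonormal_singular A
  have hin := inner_apply_singular A he hs
  rw [traceNorm_eq_tsum_sigma, ENNReal.tsum_eq_iSup_sum]
  refine iSup_le fun s => ?_
  have hf : Orthonormal ℂ fun p : SingularIndex A => (((p.1 : ℝ) : ℂ))⁻¹ • A (e p) := by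
    rw [orthonormal_iff_ite]
    intro i j
    rw [inner_smul_left, inner_smul_right, hin, ← Complex.ofReal_inv, Complex.conj_ofReal]
    split_ifs with hij
    · subst hij
      have : ((i.1 : ℝ) : ℂ) ≠ 0 := Complex.ofReal_ne_zero.2 i.1.2.ne'
      push_cast
      field_simp
    · simp
  have := h s (fun p => e p) (fun p => (((p.1.1 : ℝ) : ℂ))⁻¹ • A (e p))
    (he.comp _ Subtype.val_injective) (hf.comp _ Subtype.val_injective)
  refine le_trans (le_of_eq ?_) this
  have h1 : ∀ p : s, inner ℂ ((((p.1.1 : ℝ) : ℂ))⁻¹ • A (e p)) (A (e p)) =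
      (((p.1.1 : ℝ)) : ℂ) := fun p => by
    have : ((p.1.1 : ℝ) : ℂ) ≠ 0 := Complex.ofReal_ne_zero.2 p.1.1.2.ne'
    rw [inner_smul_left, hin, ← Complex.ofReal_inv, Complex.conj_ofReal, if_pos rfl]
    push_cast
    field_simp
  rw [Finset.sum_congr rfl fun p _ => h1 p, ← Complex.ofReal_sum, ← ofReal_norm,
    Complex.norm_real, Real.norm_of_nonneg (Finset.sum_nonneg fun p _ => p.1.1.2.le),
    ENNReal.ofReal_sum_of_nonneg fun p _ => p.1.1.2.le, ← Finset.sum_coe_sort]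

/-- With `P = |A|` one has `(P + μ)(P - μ)v = 0`, and `P + μ` is injective because `P` is positive.
This transfers the spectral theory of the compact operator `A* A` to `|A|`. -/
theorem eigenspace_adjoint_mul_self (A : H →L[ℂ] H) (μ : {μ : ℝ // 0 < μ}) :
    Module.End.eigenspace ((ContinuousLinearMap.adjoint A * A : H →L[ℂ] H) : H →ₗ[ℂ] H)
      (((μ : ℝ) : ℂ) ^ 2) = singularSpace A μ := by
  have h := CFC.abs_mul_abs A
  rw [ContinuousLinearMap.star_eq_adjoint] at h
  rw [← h]
  set P := CFC.abs A with hP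
  ext v
  rw [Module.End.mem_eigenspace_iff, singularSpace, Module.End.mem_eigenspace_iff]
  change P (P v) = _ ↔ P v = _
  constructor
  · intro hv
    set w := P v - ((μ : ℝ) : ℂ) • v with hw
    have hPw : P w = -((μ : ℝ) : ℂ) • w := by
      rw [hw, map_sub, map_smul, hv]
      module
    have hpos := (abs_isPositive A).re_inner_nonneg_left w
    rw [← hP, hPw, inner_smul_left, inner_self_eq_norm_sq_to_K] at hpos
    have h2 : RCLike.re ((starRingEnd ℂ) (-((μ : ℝ) : ℂ)) * ((‖w‖ : ℝ) : ℂ) ^ 2) =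
        -(μ : ℝ) * ‖w‖ ^ 2 := by
      rw [map_neg, Complex.conj_ofReal, ← Complex.ofReal_neg, ← Complex.ofReal_pow,
        ← Complex.ofReal_mul]
      exact Complex.ofReal_re _
    have h3 : 0 ≤ -(μ : ℝ) * ‖w‖ ^ 2 := h2 ▸ hpos
    have h4 : ‖w‖ ^ 2 ≤ 0 := by
      have := μ.2
      by_contra hcon
      nlinarith [mul_pos this (not_le.1 hcon)]
    have h5 : w = 0 := by
      rw [← norm_eq_zero]
      exact pow_eq_zero_iff two_ne_zero |>.1 (le_antisymm h4 (by positivity))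
    exact sub_eq_zero.1 h5
  · intro hv
    rw [hv, map_smul, hv, smul_smul, sq]

theorem inner_adjoint_mul_self (A : H →L[ℂ] H) (x y : H) :
    inner ℂ x ((ContinuousLinearMap.adjoint A * A : H →L[ℂ] H) y) = inner ℂ (A x) (A y) := by
  rw [mul_apply_eq_comp, ContinuousLinearMap.adjoint_inner_right]

theorem isSymmetric_adjoint_mul_self (A : H →L[ℂ] H) :
    (ContinuousLinearMap.adjoint A * A : H →L[ℂ] H).IsSymmetric := fun x y => by
  change inner ℂ ((ContinuousLinearMap.adjoint A * A : H →L[ℂ] H) x) y =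
    inner ℂ x ((ContinuousLinearMap.adjoint A * A : H →L[ℂ] H) y)
  rw [inner_adjoint_mul_self, ← inner_conj_symm, inner_adjoint_mul_self, inner_conj_symm]

/-- Pairing the eigenvalue equation with `u` gives `μ = (‖A u‖ / ‖u‖)²`. -/
theorem eigenspace_adjoint_mul_self_cases (A : H →L[ℂ] H) {μ : ℂ} (hμ : μ ≠ 0) {u : H}
    (hu : (ContinuousLinearMap.adjoint A * A : H →L[ℂ] H) u = μ • u) (hu0 : u ≠ 0) :
    ∃ s : {s : ℝ // 0 < s}, u ∈ singularSpace A s := by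
  have h1 := inner_adjoint_mul_self A u u
  have hn : ‖u‖ ≠ 0 := norm_ne_zero_iff.2 hu0
  have hnC : ((‖u‖ : ℝ) : ℂ) ≠ 0 := Complex.ofReal_ne_zero.2 hn
  rw [hu, inner_smul_right, inner_self_eq_norm_sq_to_K, inner_self_eq_norm_sq_to_K] at h1
  have hμs : μ = (((‖A u‖ / ‖u‖ : ℝ)) : ℂ) ^ 2 := by
    push_cast
    rw [div_pow, eq_div_iff (pow_ne_zero 2 hnC)]
    exact h1
  have hs : 0 < ‖A u‖ / ‖u‖ := by
    refine lt_of_le_of_ne (by positivity) fun h => hμ ?_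
    rw [hμs, ← h]
    simp
  refine ⟨⟨_, hs⟩, ?_⟩
  rw [← eigenspace_adjoint_mul_self, Module.End.mem_eigenspace_iff]
  exact hμs ▸ hu

/-- `A* A y` is orthogonal to every eigenspace of `A* A`: by symmetry for eigenvalue zero, by
hypothesis otherwise. These span a dense subspace, so `A* A y = 0` and `‖A y‖² = 0`. -/
theorem apply_eq_zero_of_orthogonal_singularSpace {A : H →L[ℂ] H} (hA : IsCompactOperator A)
    {y : H} (hy : ∀ s, ∀ u ∈ singularSpace A s, inner ℂ u y = 0) : A y = 0 := by
  have hTc : IsCompactOperator (ContinuousLinearMap.adjoint A * A : H →L[ℂ] H) :=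
    hA.clm_comp (ContinuousLinearMap.adjoint A)
  have hTs := isSymmetric_adjoint_mul_self A
  have hbot := ContinuousLinearMap.orthogonalComplement_iSup_eigenspaces_eq_bot hTc hTs
  have hTapp := inner_adjoint_mul_self A
  have hcases := fun μ hμ u => eigenspace_adjoint_mul_self_cases A (μ := μ) hμ (u := u)
  set T : H →L[ℂ] H := ContinuousLinearMap.adjoint A * A with hT
  have hmem : T y ∈ (⨆ μ, Module.End.eigenspace (T : Module.End ℂ H) μ)ᗮ := by
    rw [Submodule.mem_orthogonal]
    intro u hu
    refine Submodule.iSup_induction _ (motive := fun u => inner ℂ u (T y) = 0) hu ?_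
      (inner_zero_left _) fun u v hu hv => by rw [inner_add_left, hu, hv, add_zero]
    intro μ u hu
    have hu' : T u = μ • u := Module.End.mem_eigenspace_iff.1 hu
    have hsym : inner ℂ u (T y) = inner ℂ (T u) y := (hTs u y).symm
    rw [hsym, hu', inner_smul_left]
    by_cases hμ : μ = 0
    · simp [hμ]
    by_cases hu0 : u = 0
    · simp [hu0]
    obtain ⟨s, hs⟩ := hcases μ hμ u hu' hu0
    rw [hy s u hs, mul_zero]
  rw [hbot, Submodule.mem_bot] at hmem
  have := hTapp y y
  rw [hmem, inner_zero_right] at this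
  exact inner_self_eq_zero.1 this.symm

theorem finite_singularSpace {A : H →L[ℂ] H} (hA : IsCompactOperator A) (μ : {μ : ℝ // 0 < μ}) :
    Module.Finite ℂ (singularSpace A μ) := by
  have hTc : IsCompactOperator (ContinuousLinearMap.adjoint A * A : H →L[ℂ] H) :=
    hA.clm_comp (ContinuousLinearMap.adjoint A)
  rw [← eigenspace_adjoint_mul_self]
  exact ContinuousLinearMap.finite_dimensional_eigenspace hTc _
    (pow_ne_zero 2 (Complex.ofReal_ne_zero.2 μ.2.ne'))

theorem norm_apply_singular (A : H →L[ℂ] H) {e : SingularIndex A → H} (he : Orthonormal ℂ e)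
    (hs : ∀ i, e i ∈ singularSpace A i.1) (p : SingularIndex A) : ‖A (e p)‖ = p.1 := by
  have := inner_apply_singular A he hs p p
  rw [if_pos rfl, inner_self_eq_norm_sq_to_K] at this
  have h2 : ‖A (e p)‖ ^ 2 = (p.1 : ℝ) ^ 2 := by
    refine Complex.ofReal_injective ?_
    push_cast
    exact this
  exact (pow_left_inj₀ (norm_nonneg _) p.1.2.le two_ne_zero).1 h2

/-- The singular vectors are completed to a Hilbert basis. The added vectors are killed by `A`, and
on a singular vector `‖A e‖` is its singular value. -/
theorem exists_hilbertBasis_tsum_le_traceNorm {A : H →L[ℂ] H} (hA : IsCompactOperator A) :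
    ∃ (w : Set H) (b : HilbertBasis w ℂ H), ∑' i, ‖A (b i)‖ₑ ≤ traceNorm A := by
  obtain ⟨e, he, hs, hspan⟩ := exists_orthonormal_singular A
  obtain ⟨w, b, hew, hb⟩ := he.toSubtypeRange.exists_hilbertBasis_extension
  refine ⟨w, b, ?_⟩
  have hker : ∀ y, (∀ i, inner ℂ (e i) y = 0) → A y = 0 := by
    intro y hy
    refine apply_eq_zero_of_orthogonal_singularSpace hA fun s u hu => ?_
    refine Submodule.span_induction (p := fun u _ => inner ℂ u y = 0) ?_ (inner_zero_left _)
      (fun u v _ _ hu hv => by rw [inner_add_left, hu, hv, add_zero])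
      (fun a u _ hu => by rw [inner_smul_left, hu, mul_zero])
      (hspan s (finite_singularSpace hA s) hu)
    rintro _ ⟨i, rfl⟩
    exact hy i
  set ι : SingularIndex A → w := fun p => ⟨e p, hew ⟨p, rfl⟩⟩ with hι
  have hbι : ∀ p, b (ι p) = e p := fun p => by rw [hb]
  have hinj : Function.Injective ι := fun p q hpq =>
    he.linearIndependent.injective (congrArg Subtype.val hpq)
  rw [← hinj.tsum_eq (f := fun i => ‖A (b i)‖ₑ), traceNorm_eq_tsum_sigma]
  · refine ENNReal.tsum_le_tsum fun p => le_of_eq ?_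
    rw [hbι, ← ofReal_norm, norm_apply_singular A he hs]
  · intro i hi
    by_contra hcon
    refine hi ?_
    have : A (b i) = 0 := hker _ fun p => by
      rw [← hbι]
      exact b.orthonormal.2 fun h => hcon ⟨p, h⟩
    change ‖A (b i)‖ₑ = 0
    rw [this, enorm_zero]

end TraceNorm

/-! ### The localization operator as a Bochner integral -/

/-- The standard basis vector of `ℓ²(ℤⁿ)`. -/
def basisVec (k : IntVec n) : EllTwo n := lp.single 2 k 1

theorem norm_basisVec (k : IntVec n) : ‖basisVec k‖ = 1 := by
  rw [basisVec, lp.norm_single (by norm_num), norm_one]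

theorem inner_basisVec (k : IntVec n) (f : EllTwo n) : inner ℂ (basisVec k) f = f k := by
  rw [basisVec, lp.inner_single_left]
  simp

theorem basisVec_apply (k l : IntVec n) : basisVec k l = if l = k then 1 else 0 := by
  rw [basisVec, lp.single_apply]
  split_ifs with h
  · subst h; simp
  · simp [h]

theorem inner_eq_pairing (f h : EllTwo n) : inner ℂ h f = pairing f h := by
  rw [lp.inner_eq_tsum, pairing]
  simp

/-- The time-frequency shift of an absolutely summable sequence, as an element of `ℓ²(ℤⁿ)`. -/
def shiftVec (g : IntVec n → ℂ) (z : Phase n) : EllTwo n :=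
  ∑' k, tfShift z g k • basisVec k

theorem norm_tfShift (g : IntVec n → ℂ) (z : Phase n) (k : IntVec n) :
    ‖tfShift z g k‖ = ‖g (k - z.1)‖ := by
  simp [tfShift]

theorem summable_norm_tfShift {g : IntVec n → ℂ} (hg : Summable fun k => ‖g k‖) (z : Phase n) :
    Summable fun k => ‖tfShift z g k‖ := by
  simp_rw [norm_tfShift]
  exact (Equiv.subRight z.1).summable_iff.2 hg

theorem hasSum_shiftVec {g : IntVec n → ℂ} (hg : Summable fun k => ‖g k‖) (z : Phase n) :
    HasSum (fun k => tfShift z g k • basisVec k) (shiftVec g z) := by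
  refine (Summable.of_norm ?_).hasSum
  simpa only [norm_smul, norm_basisVec, mul_one] using summable_norm_tfShift hg z

theorem shiftVec_apply {g : IntVec n → ℂ} (hg : Summable fun k => ‖g k‖) (z : Phase n)
    (k : IntVec n) : shiftVec g z k = tfShift z g k := by
  have h := (hasSum_shiftVec hg z).mapL (innerSL ℂ (basisVec k))
  rw [innerSL_apply_apply, inner_basisVec] at h
  have h' : (fun l => innerSL ℂ (basisVec k) (tfShift z g l • basisVec l)) =
      fun l => if l = k then tfShift z g k else 0 := by
    funext l
    rw [innerSL_apply_apply, inner_basisVec, lp.coeFn_smul, Pi.smul_apply, basisVec_apply]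
    by_cases hl : l = k
    · simp [hl]
    · simp [hl, Ne.symm hl]
  rw [h'] at h
  exact h.unique (hasSum_ite_eq k _)

theorem coe_shiftVec {g : IntVec n → ℂ} (hg : Summable fun k => ‖g k‖) (z : Phase n) :
    (shiftVec g z : IntVec n → ℂ) = tfShift z g :=
  funext (shiftVec_apply hg z)

theorem enorm_shiftVec_le (g : IntVec n → ℂ) (z : Phase n) :
    ‖shiftVec g z‖ₑ ≤ ∑' k, ‖g k‖ₑ := by
  rw [← (Equiv.subRight z.1).tsum_eq]
  refine enorm_tsum_le_tsum_enorm.trans_eq (tsum_congr fun k => ?_)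
  rw [enorm_smul, ← ofReal_norm (basisVec k), norm_basisVec, ENNReal.ofReal_one, mul_one,
    ← ofReal_norm, norm_tfShift, ofReal_norm]
  rfl

/-- Norm continuity in `ℓ²` makes the rank one integrand continuous in operator norm, so the
integral exists as a Bochner integral of operators. -/
theorem continuous_shiftVec {g : IntVec n → ℂ} (hg : Summable fun k => ‖g k‖) :
    Continuous (shiftVec g) := by
  refine continuous_phase fun m => ?_
  refine continuous_tsum (u := fun k => ‖g (k - m)‖) (fun k => ?_)
    ((Equiv.subRight m).summable_iff.2 hg) fun k w => ?_
  · have := continuous_mFourier k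
    unfold tfShift
    fun_prop
  · rw [norm_smul, norm_basisVec, mul_one, norm_tfShift]

theorem norm_shiftVec_le {g : IntVec n → ℂ} (hg : Summable fun k => ‖g k‖) (z : Phase n) :
    ‖shiftVec g z‖ ≤ ∑' k, ‖g k‖ := by
  have h := enorm_shiftVec_le g z
  simp_rw [← ofReal_norm] at h
  rw [← ENNReal.ofReal_tsum_of_nonneg (fun _ => norm_nonneg _) hg] at h
  exact (ENNReal.ofReal_le_ofReal_iff (tsum_nonneg fun _ => norm_nonneg _)).1 h

/-- The localization operator as an integral of rank one operators. -/
def locOperator (σ : Phase n → ℂ) (g : IntVec n → ℂ) : EllTwo n →L[ℂ] EllTwo n :=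
  ∫ z, σ z • InnerProductSpace.rankOne ℂ (shiftVec g z) (shiftVec g z) ∂phaseMeasure n

theorem integrable_smul_rankOne {σ : Phase n → ℂ} (hσ : Integrable σ (phaseMeasure n))
    {g : IntVec n → ℂ} (hg : Summable fun k => ‖g k‖) :
    Integrable (fun z => σ z • InnerProductSpace.rankOne ℂ (shiftVec g z) (shiftVec g z))
      (phaseMeasure n) := by
  have hc := continuous_shiftVec hg
  have hc2 : Continuous fun z => InnerProductSpace.rankOne ℂ (shiftVec g z) (shiftVec g z) :=
    ((ContinuousLinearMap.smulRightL ℂ (EllTwo n) (EllTwo n)).continuous.comp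
      ((innerSL ℂ).continuous.comp hc)).clm_apply hc
  refine (hσ.norm.mul_const ((∑' k, ‖g k‖) * (∑' k, ‖g k‖))).mono'
    (hσ.1.smul hc2.aestronglyMeasurable) (.of_forall fun z => ?_)
  rw [norm_smul, InnerProductSpace.norm_rankOne]
  have := norm_shiftVec_le hg z
  gcongr

theorem locOperator_apply {σ : Phase n → ℂ} (hσ : Integrable σ (phaseMeasure n))
    {g : IntVec n → ℂ} (hg : Summable fun k => ‖g k‖) (f : EllTwo n) (k : IntVec n) :
    locOperator σ g f k = locOp σ g g f k := by
  have hi := integrable_smul_rankOne hσ hg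
  have hif := hi.apply_continuousLinearMap f
  have h1 : locOperator σ g f k = ∫ z, σ z * stft g f z * tfShift z g k ∂phaseMeasure n := by
    rw [← inner_basisVec, locOperator, ContinuousLinearMap.integral_apply hi,
      ← innerSL_apply_apply ℂ, ← ContinuousLinearMap.integral_comp_comm _ hif]
    refine integral_congr_ae (.of_forall fun z => ?_)
    simp only [smul_apply, innerSL_apply_apply, inner_smul_right,
      InnerProductSpace.rankOne_apply, inner_basisVec, inner_eq_pairing f, shiftVec_apply hg,
      coe_shiftVec hg, stft, mul_assoc]
  have h2 : Integrable (fun z => σ z * stft g f z * tfShift z g k) (phaseMeasure n) := by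
    refine ((innerSL ℂ (basisVec k)).integrable_comp hif).congr (.of_forall fun z => ?_)
    simp only [smul_apply, innerSL_apply_apply, inner_smul_right,
      InnerProductSpace.rankOne_apply, inner_basisVec, inner_eq_pairing f, shiftVec_apply hg,
      coe_shiftVec hg, stft, mul_assoc]
  rw [h1, locOp]
  exact (hasSum_integral_phase h2).tsum_eq.symm

/-- The continuous quotient map by `S` commutes with the integral and annihilates the integrand. -/
theorem integral_mem_of_isClosed {α E : Type*} [MeasurableSpace α] {μ : Measure α}
    [NormedAddCommGroup E] [NormedSpace ℂ E] [CompleteSpace E] (S : Submodule ℂ E)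
    (hS : IsClosed (S : Set E)) {f : α → E} (hf : Integrable f μ) (hfS : ∀ x, f x ∈ S) :
    ∫ x, f x ∂μ ∈ S := by
  have : IsClosed (S : Set E) := hS
  refine (Submodule.Quotient.mk_eq_zero S).1 ?_
  change S.mkQL (∫ x, f x ∂μ) = 0
  rw [← ContinuousLinearMap.integral_comp_comm _ hf]
  exact integral_eq_zero_of_ae (.of_forall fun x => (Submodule.Quotient.mk_eq_zero S).2 (hfS x))

theorem isCompactOperator_locOperator {σ : Phase n → ℂ} (hσ : Integrable σ (phaseMeasure n))
    {g : IntVec n → ℂ} (hg : Summable fun k => ‖g k‖) : IsCompactOperator (locOperator σ g) := by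
  refine integral_mem_of_isClosed (compactOperator (RingHom.id ℂ) (EllTwo n) (EllTwo n))
    isClosed_setOfPred_isCompactOperator (integrable_smul_rankOne hσ hg) fun z => ?_
  refine Submodule.smul_mem _ _ ?_
  have h := (isCompactOperator_of_locallyCompactSpace_rng
    (ContinuousLinearMap.toSpanSingleton ℂ (shiftVec g z))).comp_clm (innerSL ℂ (shiftVec g z))
  rw [InnerProductSpace.rankOne_def']
  exact h

/-- The inequality `ab ≤ (a² + b²)/2` followed by Bessel for each family: this is the trace norm
bound for a rank one operator. -/
theorem norm_sum_inner_mul_inner_le {H ι : Type*} [NormedAddCommGroup H] [InnerProductSpace ℂ H]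
    [Fintype ι] {e f : ι → H} (he : Orthonormal ℂ e) (hf : Orthonormal ℂ f) (v : H) :
    ‖∑ i, inner ℂ v (e i) * inner ℂ (f i) v‖ ≤ ‖v‖ * ‖v‖ := by
  refine (norm_sum_le _ _).trans ?_
  have h1 := he.sum_inner_products_le v (s := Finset.univ)
  have h2 := hf.sum_inner_products_le v (s := Finset.univ)
  have h3 : ∀ i, ‖inner ℂ v (e i) * inner ℂ (f i) v‖ ≤
      2⁻¹ * ‖inner ℂ (e i) v‖ ^ 2 + 2⁻¹ * ‖inner ℂ (f i) v‖ ^ 2 := fun i => by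
    rw [norm_mul, norm_inner_symm v]
    nlinarith [sq_nonneg (‖inner ℂ (e i) v‖ - ‖inner ℂ (f i) v‖)]
  refine (Finset.sum_le_sum fun i _ => h3 i).trans ?_
  rw [Finset.sum_add_distrib, ← Finset.mul_sum, ← Finset.mul_sum]
  linarith

theorem traceNorm_locOperator_le {σ : Phase n → ℂ} (hσ : Integrable σ (phaseMeasure n))
    {g : IntVec n → ℂ} (hg : Summable fun k => ‖g k‖) :
    traceNorm (locOperator σ g) ≤ (∑' k, ‖g k‖ₑ) ^ 2 * ∫⁻ z, ‖σ z‖ₑ ∂phaseMeasure n := by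
  refine traceNorm_le _ _ fun ι _ e f he hf => ?_
  have hi := integrable_smul_rankOne hσ hg
  -- The functional tested in `traceNorm_le` is continuous in operator norm, so it moves under the
  -- integral.
  let Λ : (EllTwo n →L[ℂ] EllTwo n) →L[ℂ] ℂ :=
    ∑ i, (innerSL ℂ (f i)) ∘L (ContinuousLinearMap.apply ℂ (EllTwo n) (e i))
  have hΛ : ∀ T, Λ T = ∑ i, inner ℂ (f i) (T (e i)) := fun T => by
    simp [Λ]
  rw [← hΛ, locOperator, ← ContinuousLinearMap.integral_comp_comm _ hi]
  refine (enorm_integral_le_lintegral_enorm _).trans ?_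
  rw [mul_comm, ← lintegral_mul_const'' _ hσ.1.enorm]
  refine lintegral_mono fun z => ?_
  rw [map_smul, enorm_smul]
  gcongr
  have h1 : Λ (InnerProductSpace.rankOne ℂ (shiftVec g z) (shiftVec g z)) =
      ∑ i, inner ℂ (shiftVec g z) (e i) * inner ℂ (f i) (shiftVec g z) := by
    rw [hΛ]
    simp
  rw [h1]
  refine le_trans ?_ (pow_le_pow_left' (enorm_shiftVec_le g z) 2)
  rw [sq, ← ofReal_norm, ← ofReal_norm, ← ENNReal.ofReal_mul (norm_nonneg _)]
  exact ENNReal.ofReal_le_ofReal (norm_sum_inner_mul_inner_le he hf _)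

/-! ### Absolutely convergent trigonometric series on the slices -/

theorem mFourier_sub_apply (i j : IntVec n) (y : Torus n) :
    UnitAddTorus.mFourier (i - j) y =
      UnitAddTorus.mFourier i y * conj (UnitAddTorus.mFourier j y) := by
  rw [sub_eq_add_neg, UnitAddTorus.mFourier_add, UnitAddTorus.mFourier_neg]

theorem torusCoeff_eq_of_translate (u : Torus n → ℂ) (v : Torus n) (i j : IntVec n) :
    ‖∫ y, UnitAddTorus.mFourier i y * conj (UnitAddTorus.mFourier j y * u (y - v))
      ∂torusMeasure n‖ₑ = ‖torusCoeff u (i - j)‖ₑ := by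
  have h : ∫ y, UnitAddTorus.mFourier i y * conj (UnitAddTorus.mFourier j y * u (y - v))
      ∂torusMeasure n = conj (UnitAddTorus.mFourier (i - j) (-v) * torusCoeff u (i - j)) := by
    rw [← torusCoeff_translate, ← integral_conj]
    refine integral_congr_ae (.of_forall fun y => ?_)
    simp only [map_mul, Complex.conj_conj, mFourier_sub_apply, sub_eq_add_neg y v]
    ring
  rw [h, ← ofReal_norm, RCLike.norm_conj, norm_mul, norm_mFourier_apply, one_mul, ofReal_norm]

section Series

variable {ι : Type*} {c : IntVec n → ι → ℂ} {J : ι → IntVec n}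

/-- The function on phase space whose slices are trigonometric series with frequencies `J a` and
coefficients `c m a`. -/
def sliceSeries (c : IntVec n → ι → ℂ) (J : ι → IntVec n) (x : Phase n) : ℂ :=
  ∑' a, c x.1 a * UnitAddTorus.mFourier (J a) x.2

theorem summable_of_tsum_tsum (hS : ∑' m, ∑' a, ‖c m a‖ₑ < ⊤) (m : IntVec n) :
    Summable fun a => ‖c m a‖ := by
  have h : ∑' a, ‖c m a‖ₑ ≠ ⊤ :=
    ((ENNReal.le_tsum (f := fun m => ∑' a, ‖c m a‖ₑ) m).trans_lt hS).ne
  simpa using ENNReal.summable_toReal h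

theorem continuous_sliceSeries (hS : ∑' m, ∑' a, ‖c m a‖ₑ < ⊤) :
    Continuous (sliceSeries c J) :=
  continuous_phase fun m => continuous_tsum
    (fun a => by have := continuous_mFourier (J a); fun_prop)
    (summable_of_tsum_tsum hS m) fun a w => by simp

theorem enorm_sliceSeries_le (x : Phase n) : ‖sliceSeries c J x‖ₑ ≤ ∑' a, ‖c x.1 a‖ₑ :=
  enorm_tsum_le_tsum_enorm.trans_eq (tsum_congr fun a => by simp [enorm_mul])

theorem integrable_sliceSeries (hS : ∑' m, ∑' a, ‖c m a‖ₑ < ⊤) :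
    Integrable (sliceSeries c J) (phaseMeasure n) := by
  refine ⟨(continuous_sliceSeries hS).aestronglyMeasurable, ?_⟩
  rw [hasFiniteIntegral_iff_enorm, lintegral_phase]
  refine lt_of_le_of_lt (ENNReal.tsum_le_tsum fun m => ?_) hS
  refine (lintegral_mono fun w => enorm_sliceSeries_le (m, w)).trans_eq ?_
  simp

theorem isPhaseTempered_of_integrable {F : Phase n → ℂ} (hF : Integrable F (phaseMeasure n)) :
    IsPhaseTempered F :=
  ⟨0, by simpa using hF⟩

theorem IsPhaseSchwartz.bounded {Φ : Phase n → ℂ} (hΦ : IsPhaseSchwartz Φ) :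
    ∃ B, ∀ z, ‖Φ z‖ ≤ B := by
  obtain ⟨C, hC⟩ := hΦ.decay 0
  exact ⟨C, fun z => by simpa using hC z⟩

/-- On a single term of the series the transform is, up to a phase and conjugation, a Fourier
coefficient of a window slice. The bound no longer involves the torus components of `z` and `ζ`. -/
theorem enorm_phaseStft_sliceSeries_le [Countable ι] {Φ : Phase n → ℂ} (hΦ : IsPhaseSchwartz Φ)
    (hS : ∑' m, ∑' a, ‖c m a‖ₑ < ⊤) (z ζ : Phase n) :
    ‖phaseStft Φ (sliceSeries c J) z ζ‖ₑ ≤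
      ∑' l, ∑' a, ‖c l a‖ₑ * ‖torusCoeff (fun w => Φ (l - z.1, w)) (J a - ζ.1)‖ₑ := by
  obtain ⟨B, hB⟩ := hΦ.bounded
  have hΦc := hΦ.continuous
  have hζ := continuous_phaseChar ζ
  have hint : Integrable (fun x => sliceSeries c J x * conj (phaseChar ζ x * Φ (x - z)))
      (phaseMeasure n) :=
    (integrable_sliceSeries hS).mul_bdd (c := B) (Continuous.aestronglyMeasurable (by fun_prop))
      (.of_forall fun x => by simpa using hB _)
  rw [phaseStft, ← (hasSum_integral_phase hint).tsum_eq]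
  refine enorm_tsum_le_tsum_enorm.trans (ENNReal.tsum_le_tsum fun l => ?_)
  have h1 := hasSum_integral_mul_of_summable (μ := torusMeasure n)
    (f := fun a y => c l a * UnitAddTorus.mFourier (J a) y * conj (phaseChar ζ (l, y) *
      Φ ((l, y) - z))) (b := fun a => ‖c l a‖ * B)
    (fun a => by
      have := continuous_mFourier (J a)
      exact Continuous.aestronglyMeasurable (by fun_prop))
    ((summable_of_tsum_tsum hS l).mul_right B)
    (fun a y => by
      simp only [norm_mul, norm_mFourier_apply, mul_one, RCLike.norm_conj, norm_phaseChar, one_mul]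
      gcongr
      exact hB _)
  simp_rw [tsum_mul_right] at h1
  simp only [sliceSeries]
  rw [← h1.tsum_eq]
  refine enorm_tsum_le_tsum_enorm.trans (ENNReal.tsum_le_tsum fun a => le_of_eq ?_)
  have h2 : ∀ y, c l a * UnitAddTorus.mFourier (J a) y * conj (phaseChar ζ (l, y) *
      Φ ((l, y) - z)) = (c l a * conj (UnitAddTorus.mFourier l ζ.2)) *
      (UnitAddTorus.mFourier (J a) y * conj (UnitAddTorus.mFourier ζ.1 y *
        Φ (l - z.1, y - z.2))) := fun y => by
    have h3 : ((l, y) : Phase n) - z = (l - z.1, y - z.2) := rfl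
    simp only [phaseChar, map_mul, h3]
    ring
  simp_rw [h2]
  rw [integral_const_mul, enorm_mul, enorm_mul,
    torusCoeff_eq_of_translate (fun w => Φ (l - z.1, w)) z.2 (J a) ζ.1]
  congr 1
  rw [← ofReal_norm (conj _), RCLike.norm_conj, norm_mFourier_apply, ENNReal.ofReal_one, mul_one]

/-- The torus integrals have mass one, leaving a convolution on `ℤⁿ × ℤⁿ`; by translation invariance
each coefficient contributes its modulus times the full `wienerNorm`. -/
theorem phaseM1Norm_sliceSeries_le [Countable ι] {Φ : Phase n → ℂ} (hΦ : IsPhaseSchwartz Φ)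
    (hS : ∑' m, ∑' a, ‖c m a‖ₑ < ⊤) :
    phaseM1Norm Φ (sliceSeries c J) ≤ wienerNorm Φ * ∑' m, ∑' a, ‖c m a‖ₑ := by
  calc phaseM1Norm Φ (sliceSeries c J)
      ≤ ∫⁻ z, ∫⁻ ζ, ∑' l, ∑' a, ‖c l a‖ₑ *
          ‖torusCoeff (fun w => Φ (l - z.1, w)) (J a - ζ.1)‖ₑ ∂phaseMeasure n ∂phaseMeasure n :=
        lintegral_mono fun z => lintegral_mono fun ζ => enorm_phaseStft_sliceSeries_le hΦ hS z ζ
    _ = ∑' m, ∑' j, ∑' l, ∑' a, ‖c l a‖ₑ *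
          ‖torusCoeff (fun w => Φ (l - m, w)) (J a - j)‖ₑ := by
        simp only [lintegral_phase, lintegral_const, measure_univ, mul_one]
    _ = ∑' l, ∑' a, ∑' m, ∑' j, ‖c l a‖ₑ *
          ‖torusCoeff (fun w => Φ (l - m, w)) (J a - j)‖ₑ := by
        simp_rw [ENNReal.tsum_comm (α := IntVec n) (β := IntVec n)
          (f := fun j l => ∑' a, ‖c l a‖ₑ * ‖torusCoeff (fun w => Φ (l - _, w)) (J a - j)‖ₑ)]
        rw [ENNReal.tsum_comm]
        refine tsum_congr fun l => ?_
        simp_rw [ENNReal.tsum_comm (α := IntVec n) (β := ι)]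
    _ = ∑' l, ∑' a, ‖c l a‖ₑ * wienerNorm Φ := by
        refine tsum_congr fun l => tsum_congr fun a => ?_
        simp_rw [ENNReal.tsum_mul_left]
        congr 1
        rw [wienerNorm, ← (Equiv.subLeft l).tsum_eq]
        refine tsum_congr fun m => ?_
        rw [← (Equiv.subLeft (J a)).tsum_eq]
        simp only [Equiv.subLeft_apply, sub_sub_cancel]
    _ = _ := by
        simp_rw [ENNReal.tsum_mul_right]
        rw [mul_comm]

end Series

/-! ### The lower symbol -/

theorem lowerSymbol_eq_sliceSeries {σ : Phase n → ℂ} {g : IntVec n → ℂ}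
    (hg : Summable fun k => ‖g k‖) {L : EllTwo n →L[ℂ] EllTwo n}
    (hL : ∀ f k, L f k = locOp σ g g f k) :
    lowerSymbol σ g = sliceSeries (fun m (p : IntVec n × IntVec n) =>
      conj (g (p.1 - m)) * g (p.2 - m) * inner ℂ (basisVec p.1) (L (basisVec p.2)))
      fun p => p.2 - p.1 := by
  funext z
  have h1 : lowerSymbol σ g z = inner ℂ (shiftVec g z) (L (shiftVec g z)) := by
    rw [inner_eq_pairing, lowerSymbol, coe_shiftVec hg]
    congr 1
    funext k
    rw [hL, coe_shiftVec hg]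
  have hs := hasSum_shiftVec hg z
  have h2 : ∀ v : EllTwo n, HasSum (fun l => conj (tfShift z g l) * inner ℂ (basisVec l) v)
      (inner ℂ (shiftVec g z) v) := fun v => by
    have := hs.mapL ((innerSLFlip ℂ v))
    simpa [inner_smul_left] using this
  have h3 : ∀ l, HasSum (fun k => tfShift z g k * inner ℂ (basisVec l) (L (basisVec k)))
      (inner ℂ (basisVec l) (L (shiftVec g z))) := fun l => by
    have := hs.mapL ((innerSL ℂ (basisVec l)) ∘L L)
    simpa [inner_smul_right] using this
  have hsn := summable_norm_tfShift hg z
  -- The matrix entries of `L` are bounded by `‖L‖` and `g` is in `ℓ¹`, so the iterated sums merge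
  -- into one over pairs.
  have h4 : Summable fun p : IntVec n × IntVec n => conj (tfShift z g p.1) *
      (tfShift z g p.2 * inner ℂ (basisVec p.1) (L (basisVec p.2))) := by
    refine Summable.of_norm_bounded
      ((hsn.mul_of_nonneg hsn (fun _ => norm_nonneg _) (fun _ => norm_nonneg _)).mul_right ‖L‖)
      fun p => ?_
    rw [norm_mul, norm_mul, RCLike.norm_conj, mul_assoc]
    gcongr
    refine (norm_inner_le_norm _ _).trans ?_
    rw [norm_basisVec, one_mul]
    simpa [norm_basisVec] using L.le_opNorm (basisVec p.2)
  rw [h1, ← (h2 _).tsum_eq, sliceSeries]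
  simp_rw [← fun l => (h3 l).tsum_eq, ← tsum_mul_left]
  rw [← h4.tsum_prod]
  refine tsum_congr fun p => ?_
  simp only [tfShift, map_mul, mFourier_sub_apply]
  ring

theorem tsum_enorm_rpow_eq (x : EllTwo n) : ∑' m, ‖x m‖ₑ ^ (2 : ℝ) = ‖x‖ₑ ^ (2 : ℝ) := by
  have h := lp.hasSum_norm (p := 2) (by norm_num) x
  simp only [ENNReal.toReal_ofNat] at h
  simp_rw [← ofReal_norm, ENNReal.ofReal_rpow_of_nonneg (norm_nonneg _) zero_le_two]
  rw [← ENNReal.ofReal_tsum_of_nonneg (fun _ => by positivity) h.summable, h.tsum_eq]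

theorem tsum_mul_le_enorm_mul_enorm (x y : EllTwo n) (p q : IntVec n) :
    ∑' m, ‖x (m + p)‖ₑ * ‖y (m + q)‖ₑ ≤ ‖x‖ₑ * ‖y‖ₑ := by
  have h := ENNReal.lintegral_mul_le_Lp_mul_Lq (Measure.count : Measure (IntVec n))
    Real.HolderConjugate.two_two (f := fun m => ‖x (m + p)‖ₑ) (g := fun m => ‖y (m + q)‖ₑ)
    (Measurable.of_discrete).aemeasurable (Measurable.of_discrete).aemeasurable
  simp only [lintegral_count, Pi.mul_apply] at h
  refine h.trans_eq ?_
  have h1 : ∀ (x : EllTwo n) (p : IntVec n),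
      (∑' m, ‖x (m + p)‖ₑ ^ (2 : ℝ)) ^ (1 / 2 : ℝ) = ‖x‖ₑ := fun x p => by
    have h2 : ∑' m, ‖x (m + p)‖ₑ ^ (2 : ℝ) = ∑' m, ‖x m‖ₑ ^ (2 : ℝ) :=
      (Equiv.addRight p).tsum_eq (fun m => ‖x m‖ₑ ^ (2 : ℝ))
    rw [h2, tsum_enorm_rpow_eq, ← ENNReal.rpow_mul]
    norm_num
  rw [h1, h1]

/-- After shifting both indices by `m`, the factors in `g` no longer depend on `m`, and
Cauchy-Schwarz applies to the sum over `m`. -/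
theorem tsum_convolution_le (g : IntVec n → ℂ) (x y : EllTwo n) :
    ∑' m, ∑' p : IntVec n × IntVec n,
      ‖g (p.1 - m)‖ₑ * ‖g (p.2 - m)‖ₑ * (‖x p.2‖ₑ * ‖y p.1‖ₑ) ≤
      (∑' k, ‖g k‖ₑ) ^ 2 * (‖x‖ₑ * ‖y‖ₑ) := by
  calc ∑' m, ∑' p : IntVec n × IntVec n,
        ‖g (p.1 - m)‖ₑ * ‖g (p.2 - m)‖ₑ * (‖x p.2‖ₑ * ‖y p.1‖ₑ)
      = ∑' m, ∑' p : IntVec n × IntVec n,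
        ‖g p.1‖ₑ * ‖g p.2‖ₑ * (‖x (m + p.2)‖ₑ * ‖y (m + p.1)‖ₑ) := by
        refine tsum_congr fun m => ?_
        rw [← ((Equiv.addLeft m).prodCongr (Equiv.addLeft m)).tsum_eq]
        simp
    _ = ∑' p : IntVec n × IntVec n, ‖g p.1‖ₑ * ‖g p.2‖ₑ *
        ∑' m, (‖x (m + p.2)‖ₑ * ‖y (m + p.1)‖ₑ) := by
        rw [ENNReal.tsum_comm]
        simp_rw [ENNReal.tsum_mul_left]
    _ ≤ ∑' p : IntVec n × IntVec n, ‖g p.1‖ₑ * ‖g p.2‖ₑ * (‖x‖ₑ * ‖y‖ₑ) := by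
        gcongr
        exact tsum_mul_le_enorm_mul_enorm x y _ _
    _ = _ := by
        rw [ENNReal.tsum_mul_right, ENNReal.tsum_prod (f := fun a b => ‖g a‖ₑ * ‖g b‖ₑ)]
        simp_rw [ENNReal.tsum_mul_left, ENNReal.tsum_mul_right]
        rw [sq]

/-- In the adapted basis `b`, the matrix of `L` is the sum over `i` of the rank one matrices `L(b
i)(l) conj (b i k)`. Each contributes at most `‖g‖₁² ‖b i‖ ‖L (b i)‖`, and these norms add up to at
most the trace norm. -/
theorem tsum_lowerSymbol_coeff_le (g : IntVec n → ℂ) {L : EllTwo n →L[ℂ] EllTwo n}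
    (hL : IsCompactOperator L) :
    ∑' m, ∑' p : IntVec n × IntVec n,
      ‖conj (g (p.1 - m)) * g (p.2 - m) * inner ℂ (basisVec p.1) (L (basisVec p.2))‖ₑ ≤
      (∑' k, ‖g k‖ₑ) ^ 2 * traceNorm L := by
  obtain ⟨w, b, hb⟩ := exists_hilbertBasis_tsum_le_traceNorm hL
  have h1 : ∀ k l, ‖inner ℂ (basisVec l) (L (basisVec k))‖ₑ ≤
      ∑' i, ‖b i k‖ₑ * ‖L (b i) l‖ₑ := fun k l => by
    have h := (b.hasSum_repr (basisVec k)).mapL ((innerSL ℂ (basisVec l)) ∘L L)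
    have h' : inner ℂ (basisVec l) (L (basisVec k)) =
        ∑' i, conj (inner ℂ (basisVec k) (b i)) * inner ℂ (basisVec l) (L (b i)) := by
      refine (h.tsum_eq.symm.trans (tsum_congr fun i => ?_))
      rw [ContinuousLinearMap.comp_apply, map_smul, innerSL_apply_apply, inner_smul_right,
        b.repr_apply_apply, inner_conj_symm]
    rw [h']
    refine enorm_tsum_le_tsum_enorm.trans_eq (tsum_congr fun i => ?_)
    rw [enorm_mul, ← ofReal_norm (conj _), RCLike.norm_conj, ofReal_norm, inner_basisVec,
      inner_basisVec]
  calc _ ≤ ∑' m, ∑' p : IntVec n × IntVec n, ‖g (p.1 - m)‖ₑ * ‖g (p.2 - m)‖ₑ *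
        ∑' i, ‖b i p.2‖ₑ * ‖L (b i) p.1‖ₑ := by
        refine ENNReal.tsum_le_tsum fun m => ENNReal.tsum_le_tsum fun p => ?_
        rw [enorm_mul, enorm_mul, ← ofReal_norm (conj _), RCLike.norm_conj, ofReal_norm]
        gcongr
        exact h1 _ _
    _ = ∑' i, ∑' m, ∑' p : IntVec n × IntVec n, ‖g (p.1 - m)‖ₑ * ‖g (p.2 - m)‖ₑ *
        (‖b i p.2‖ₑ * ‖L (b i) p.1‖ₑ) := by
        simp_rw [← ENNReal.tsum_mul_left]
        rw [ENNReal.tsum_comm (α := w)]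
        exact tsum_congr fun m => ENNReal.tsum_comm
    _ ≤ ∑' i, (∑' k, ‖g k‖ₑ) ^ 2 * (‖b i‖ₑ * ‖L (b i)‖ₑ) :=
        ENNReal.tsum_le_tsum fun i => tsum_convolution_le g _ _
    _ ≤ _ := by
        rw [ENNReal.tsum_mul_left]
        gcongr
        refine le_trans (le_of_eq (tsum_congr fun i => ?_)) hb
        rw [← ofReal_norm (b i), b.orthonormal.1, ENNReal.ofReal_one, one_mul]

/-! ### Constants and conclusion -/

theorem summable_norm_of_memM1 {φ g : IntVec n → ℂ} (hφ : IsSchwartz φ) (hg : MemM1 φ g)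
    {k₀ : IntVec n} (hk : φ k₀ ≠ 0) : Summable fun k => ‖g k‖ := by
  have h := (enorm_mul_tsum_le_m1Norm hφ hg.1 k₀).trans_lt hg.2
  have h1 : ∑' k, ‖g k‖ₑ ≠ ⊤ := fun htop => by
    rw [htop, ENNReal.mul_top (enorm_ne_zero.2 hk)] at h
    exact h.ne rfl
  simpa using ENNReal.summable_toReal h1

theorem integrable_of_phaseMemM1 {Φ F : Phase n → ℂ} (hΦ : IsPhaseSchwartz Φ)
    (hF : PhaseMemM1 Φ F) {z₀ : Phase n} (hz : Φ z₀ ≠ 0) : Integrable F (phaseMeasure n) := by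
  refine ⟨aestronglyMeasurable_of_isPhaseTempered hF.1, ?_⟩
  have h := (enorm_mul_lintegral_le_phaseM1Norm hΦ hF.1 z₀).trans_lt hF.2
  rw [hasFiniteIntegral_iff_enorm, lt_top_iff_ne_top]
  intro htop
  rw [htop, ENNReal.mul_top (enorm_ne_zero.2 hz)] at h
  exact h.ne rfl

/-- The two norm estimates, for every constant `C` controlled by the windows. -/
theorem exists_locOperator_bounds {φ : IntVec n → ℂ} (hφ : IsSchwartz φ) {Φ : Phase n → ℂ}
    (hΦ : IsPhaseSchwartz Φ) {k₀ : IntVec n} (hk : φ k₀ ≠ 0) {z₀ : Phase n} (hz : Φ z₀ ≠ 0)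
    {C : ℝ≥0∞} (hC1 : 1 ≤ C * (‖φ k₀‖ₑ ^ 2 * ‖Φ z₀‖ₑ)) (hC2 : wienerNorm Φ ≤ C * ‖φ k₀‖ₑ ^ 2)
    {σ : Phase n → ℂ} {g : IntVec n → ℂ} (hσ : PhaseMemM1 Φ σ) (hg : MemM1 φ g) :
    ∃ L : EllTwo n →L[ℂ] EllTwo n, (∀ (f : EllTwo n) (k : IntVec n), L f k = locOp σ g g f k) ∧
      IsTraceClass L ∧ PhaseMemM1 Φ (lowerSymbol σ g) ∧
      phaseM1Norm Φ (lowerSymbol σ g) ≤ C * traceNorm L * m1Norm φ g ^ 2 ∧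
      traceNorm L ≤ C * (m1Norm φ g ^ 2 * phaseM1Norm Φ σ) := by
  have hgs := summable_norm_of_memM1 hφ hg hk
  have hσi := integrable_of_phaseMemM1 hΦ hσ hz
  have hL := locOperator_apply hσi hgs
  have hLc := isCompactOperator_locOperator hσi hgs
  have hLt := traceNorm_locOperator_le hσi hgs
  set L := locOperator σ g
  set G := ∑' k, ‖g k‖ₑ with hG
  have hGtop : G < ⊤ := by
    simp only [hG, ← ofReal_norm]
    rw [← ENNReal.ofReal_tsum_of_nonneg (fun _ => norm_nonneg _) hgs]
    exact ENNReal.ofReal_lt_top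
  have hLfin : traceNorm L < ⊤ :=
    hLt.trans_lt (ENNReal.mul_lt_top (ENNReal.pow_lt_top hGtop) hσi.2)
  have hgG : ‖φ k₀‖ₑ * G ≤ m1Norm φ g := enorm_mul_tsum_le_m1Norm hφ hg.1 k₀
  have hσS := enorm_mul_lintegral_le_phaseM1Norm hΦ hσ.1 z₀
  have hS := tsum_lowerSymbol_coeff_le g hLc
  have hStop := hS.trans_lt (ENNReal.mul_lt_top (ENNReal.pow_lt_top hGtop) hLfin)
  have heq := lowerSymbol_eq_sliceSeries hgs hL
  have hnorm : phaseM1Norm Φ (lowerSymbol σ g) ≤ wienerNorm Φ * (G ^ 2 * traceNorm L) := by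
    rw [heq]
    exact (phaseM1Norm_sliceSeries_le hΦ hStop).trans (by gcongr)
  refine ⟨L, hL, ⟨hLc, hLfin⟩, ⟨?_, hnorm.trans_lt (ENNReal.mul_lt_top hΦ.wienerNorm_lt_top
    (ENNReal.mul_lt_top (ENNReal.pow_lt_top hGtop) hLfin))⟩, ?_, ?_⟩
  · rw [heq]
    exact isPhaseTempered_of_integrable (integrable_sliceSeries hStop)
  · calc _ ≤ wienerNorm Φ * (G ^ 2 * traceNorm L) := hnorm
      _ ≤ (C * ‖φ k₀‖ₑ ^ 2) * (G ^ 2 * traceNorm L) := by gcongr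
      _ = C * traceNorm L * (‖φ k₀‖ₑ * G) ^ 2 := by ring
      _ ≤ _ := by gcongr
  · calc _ ≤ G ^ 2 * ∫⁻ z, ‖σ z‖ₑ ∂phaseMeasure n := hLt
      _ ≤ (C * (‖φ k₀‖ₑ ^ 2 * ‖Φ z₀‖ₑ)) * (G ^ 2 * ∫⁻ z, ‖σ z‖ₑ ∂phaseMeasure n) :=
        le_mul_of_one_le_left' hC1
      _ = C * ((‖φ k₀‖ₑ * G) ^ 2 * (‖Φ z₀‖ₑ * ∫⁻ z, ‖σ z‖ₑ ∂phaseMeasure n)) := by ring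
      _ ≤ _ := by gcongr

theorem exists_window_constant {φ : IntVec n → ℂ} (hφ0 : φ ≠ 0) {Φ : Phase n → ℂ}
    (hΦ : IsPhaseSchwartz Φ) (hΦ0 : Φ ≠ 0) :
    ∃ C : ℝ≥0, 0 < C ∧ (NormalizedWindows φ Φ → C = 1) ∧ ∃ k₀ z₀, φ k₀ ≠ 0 ∧ Φ z₀ ≠ 0 ∧
      1 ≤ (C : ℝ≥0∞) * (‖φ k₀‖ₑ ^ 2 * ‖Φ z₀‖ₑ) ∧ wienerNorm Φ ≤ C * ‖φ k₀‖ₑ ^ 2 := by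
  by_cases hN : NormalizedWindows φ Φ
  · obtain ⟨⟨k₀, hk⟩, ⟨z₀, hz⟩, hW⟩ := hN
    have hk' : 1 ≤ ‖φ k₀‖ₑ := by
      rw [← ofReal_norm]; exact ENNReal.one_le_ofReal.2 hk
    have hz' : 1 ≤ ‖Φ z₀‖ₑ := by
      rw [← ofReal_norm]; exact ENNReal.one_le_ofReal.2 hz
    refine ⟨1, one_pos, fun _ => rfl, k₀, z₀, ?_, ?_, ?_, ?_⟩
    · exact enorm_ne_zero.1 (one_pos.trans_le hk').ne'
    · exact enorm_ne_zero.1 (one_pos.trans_le hz').ne'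
    · rw [ENNReal.coe_one, one_mul]
      exact one_le_mul (one_le_pow_of_one_le' hk' 2) hz'
    · rw [ENNReal.coe_one, one_mul]
      exact le_trans hW (one_le_pow_of_one_le' hk' 2)
  · obtain ⟨k₀, hk⟩ := Function.ne_iff.1 hφ0
    obtain ⟨z₀, hz⟩ := Function.ne_iff.1 hΦ0
    have hkn : ‖φ k₀‖₊ ≠ 0 := nnnorm_ne_zero_iff.2 hk
    have hzn : ‖Φ z₀‖₊ ≠ 0 := nnnorm_ne_zero_iff.2 hz
    lift wienerNorm Φ to ℝ≥0 using hΦ.wienerNorm_lt_top.ne with W hW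
    -- The sum of the least constants allowed by the two requirements.
    refine ⟨(‖φ k₀‖₊ ^ 2 * ‖Φ z₀‖₊)⁻¹ + W / ‖φ k₀‖₊ ^ 2, by positivity, fun h => absurd h hN,
      k₀, z₀, hk, hz, ?_, ?_⟩
    · simp only [enorm_eq_nnnorm]
      norm_cast
      rw [add_mul, inv_mul_cancel₀ (by positivity)]
      exact le_self_add
    · simp only [enorm_eq_nnnorm]
      norm_cast
      rw [add_mul, div_mul_cancel₀ _ (by positivity)]
      exact le_add_self

end DiscreteTF

end

theorem mainTheorem5 (n : ℕ)
    (φ : DiscreteTF.IntVec n → ℂ) (hφ : DiscreteTF.IsSchwartz φ) (hφ0 : φ ≠ 0)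
    (Φ : DiscreteTF.Phase n → ℂ) (hΦ : DiscreteTF.IsPhaseSchwartz Φ) (hΦ0 : Φ ≠ 0) :
    ∃ C : ℝ≥0, 0 < C ∧ (DiscreteTF.NormalizedWindows φ Φ → C = 1) ∧
      ∀ (σ : DiscreteTF.Phase n → ℂ) (g : DiscreteTF.IntVec n → ℂ),
        DiscreteTF.PhaseMemM1 Φ σ → DiscreteTF.MemM1 φ g →
        ∃ L : DiscreteTF.EllTwo n →L[ℂ] DiscreteTF.EllTwo n,
          (∀ (f : DiscreteTF.EllTwo n) (k : DiscreteTF.IntVec n),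
            L f k = DiscreteTF.locOp σ g g f k) ∧
          DiscreteTF.IsTraceClass L ∧
          DiscreteTF.PhaseMemM1 Φ (DiscreteTF.lowerSymbol σ g) ∧
          (g ≠ 0 →
            DiscreteTF.phaseM1Norm Φ (DiscreteTF.lowerSymbol σ g) / DiscreteTF.m1Norm φ g ^ 2
              ≤ C * DiscreteTF.traceNorm L) ∧
          DiscreteTF.traceNorm L ≤
            C * (DiscreteTF.m1Norm φ g ^ 2 * DiscreteTF.phaseM1Norm Φ σ) := by
  obtain ⟨C, hC0, hCN, k₀, z₀, hk, hz, hC1, hC2⟩ :=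
    DiscreteTF.exists_window_constant hφ0 hΦ hΦ0
  refine ⟨C, hC0, hCN, fun σ g hσ hg => ?_⟩
  obtain ⟨L, hL, hT, hM, h1, h2⟩ :=
    DiscreteTF.exists_locOperator_bounds hφ hΦ hk hz hC1 hC2 hσ hg
  -- In `[0, ∞]`, `a ≤ b * c` yields `a / c ≤ b` for every value of `c`.
  exact ⟨L, hL, hT, hM, fun _ => ENNReal.div_le_of_le_mul h1, h2⟩
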